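/- Let $A\in\mathbb R^{m\times n}$ have rank $m$, let $b\in\mathbb R^m$ and $c\in\mathbb R^n$ with $\|c\|_2=1$, and suppose that the linear program $P:\ \min\{c^Tx \mid Ax=b,\ x\ge 0\}$ is feasible and bounded. Let $K\ge 1$ and let $j_1,\dots,j_K$ be random indices in $[n]=\{1,\dots,n\}$, each with the same distribution $\xi$, i.e. $\Pr[j_k=t]=\xi_t$ for all $k\in[K]$, $t\in[n]$, but not necessarily independent. Let $G$ be a dependency graph of $j_1,\dots,j_K$: a simple undirected graph with vertex set $[K]$ such that, for all disjoint $S,T\subseteq[K]$ with no edge of $G$ between $S$ and $T$, the families $(j_k)_{k\in S}$ and $(j_k)_{k\in T}$ are independent. Let $|E(G)|$ be the number of edges of $G$. A forest approximation of $G$ is a pair $(\phi,F)$ of a finite forest $F$ and a map $\phi:V(G)\to V(F)$ such that for every edge $\langle u,v\rangle$ of $G$ either $\phi(u)=\phi(v)$ or $\langle\phi(u),\phi(v)\rangle\in E(F)$. The forest complexity of $G$ is $$\Lambda(G)=\min_{(\phi,F)}\Big[\sum_{\langle u,v\rangle\in E(F)}\big(|\phi^{-1}(u)|+|\phi^{-1}(v)|\big)^2+\sum_{i}\min_{u\in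 V(T_i)}|\phi^{-1}(u)|^2\Big],$$ the minimum being over all forest approximations of $G$, where $T_1,T_2,\dots$ are the trees (connected components) of $F$. Write $A_J=[A_{j_1},\dots,A_{j_K}]$ and $c_J=(c_{j_1},\dots,c_{j_K})$ for the sampled columns and costs, and consider $$P_J:\ \min\{c_J^T\tilde x\mid A_J\tilde x=b,\ \tilde x\ge 0\},\qquad P_{\mathrm{distr}}:\ \min\{c^Tx\mid Ax=b,\ 0\le x\le C\xi\},$$ where $C\ge 0$ is a constant. For a problem $P'$ let $v(P')$ be its optimal value ($+\infty$ if $P'$ is infeasible) and $\Delta v(P')=v(P')-v(P)$. A basis is a set $B\subseteq[n]$ of $m$ indices for which the $m\times m$ matrix $A_B$ is nonsingular; its dual basic solution $p$ is given by $p^T=c_B^TA_B^{-1}$, and its reduced cost vector by $\bar c^T=c^T-c_B^TA_B^{-1}A$. Let $\gamma$ be an upper bound on $\|p\|_\infty$ over the dual basic solutions of all bases, let $\chi$ be an upper bound on $\|\bar c\|_2$ over the reduced cost vectors of all bases, and let $\|A\|_{\max}=\max_{i,j}|A_{ij}|$. Then, for every $\delta\in(0,1)$: (i) with probability at least $1-\delta$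 over the sample $J$, the following holds: if $P_J$ is feasible and $\operatorname{rank}(A_J)=m$, then $$\Delta v(P_J)\le\Delta v(P_{\mathrm{distr}})+C\,(1+m\gamma\|A\|_{\max})\left(\sqrt{\frac{K+2|E(G)|}{K^2}}+\sqrt{\frac{2\Lambda(G)\log(2/\delta)}{K^2}}\right);$$ (ii) with probability at least $1-\delta$ over the sample $J$, the following holds: if $P_J$ is feasible and $\operatorname{rank}(A_J)=m$, then $$\Delta v(P_J)\le\Delta v(P_{\mathrm{distr}})+C\,\chi\left(\sqrt{\frac{K+2|E(G)|}{K^2}}+\sqrt{\frac{2\Lambda(G)\log(1/\delta)}{K^2}}\right).$$ -/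

import Mathlib

open MeasureTheory ProbabilityTheory Matrix

noncomputable section

/-! Linear programs -/

/-- The feasible region of the standard form problem `min {cᵀx | A x = b, x ≥ 0}`. -/
def stdFeasible {m : ℕ} {ι : Type*} [Fintype ι] (A : Matrix (Fin m) ι ℝ) (b : Fin m → ℝ) :
    Set (ι → ℝ) :=
  {x | A *ᵥ x = b ∧ 0 ≤ x}

/-- The optimal value of `min {cᵀx | x ∈ S}`; it is `⊤` if `S` is empty and `⊥` if the objective is
unbounded below on `S`. -/
def optValue {ι : Type*} [Fintype ι] (c : ι → ℝ) (S : Set (ι → ℝ)) : EReal :=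
  ⨅ x ∈ S, ((c ⬝ᵥ x : ℝ) : EReal)

/-- The feasible region of the distributional counterpart: `A x = b`, `0 ≤ x ≤ C ξ`. -/
def distrFeasible {m n : ℕ} (A : Matrix (Fin m) (Fin n) ℝ) (b : Fin m → ℝ) (C : ℝ)
    (ξ : Fin n → ℝ) : Set (Fin n → ℝ) :=
  {x | A *ᵥ x = b ∧ 0 ≤ x ∧ x ≤ C • ξ}

/-- The matrix `A_J = [A_{j₁}, …, A_{j_K}]` of the (possibly repeated) columns listed by `J`. -/
def colSub {m n K : ℕ} (A : Matrix (Fin m) (Fin n) ℝ) (J : Fin K → Fin n) :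
    Matrix (Fin m) (Fin K) ℝ :=
  A.submatrix id J

/-- `Δv(P_J) = v(P_J) - v(P)` for the column-randomized problem with sampled columns `J`. -/
def gapSampled {m n K : ℕ} (A : Matrix (Fin m) (Fin n) ℝ) (b : Fin m → ℝ) (c : Fin n → ℝ)
    (J : Fin K → Fin n) : EReal :=
  optValue (c ∘ J) (stdFeasible (colSub A J) b) - optValue c (stdFeasible A b)

/-- `Δv(P_distr) = v(P_distr) - v(P)`. -/
def gapDistr {m n : ℕ} (A : Matrix (Fin m) (Fin n) ℝ) (b : Fin m → ℝ) (c : Fin n → ℝ)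
    (C : ℝ) (ξ : Fin n → ℝ) : EReal :=
  optValue c (distrFeasible A b C ξ) - optValue c (stdFeasible A b)

/-- `B` enumerates a basis: the `m × m` matrix `A_B` is nonsingular (so `B` has no repetitions). -/
def IsLPBasis {m n : ℕ} (A : Matrix (Fin m) (Fin n) ℝ) (B : Fin m → Fin n) : Prop :=
  IsUnit (A.submatrix id B).det

/-- The dual basic solution `pᵀ = c_Bᵀ A_B⁻¹`. It does not depend on the order in which the
elements of the basis are listed. -/
def dualBasicSolution {m n : ℕ} (A : Matrix (Fin m) (Fin n) ℝ) (c : Fin n → ℝ)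
    (B : Fin m → Fin n) : Fin m → ℝ :=
  (c ∘ B) ᵥ* (A.submatrix id B)⁻¹

/-- The reduced cost vector `cᵀ - c_Bᵀ A_B⁻¹ A`. -/
def reducedCost {m n : ℕ} (A : Matrix (Fin m) (Fin n) ℝ) (c : Fin n → ℝ)
    (B : Fin m → Fin n) : Fin n → ℝ :=
  c - dualBasicSolution A c B ᵥ* A

/-- The largest absolute value of an entry of `A`. -/
def maxNorm {m n : ℕ} (A : Matrix (Fin m) (Fin n) ℝ) : ℝ :=
  ⨆ ij : Fin m × Fin n, |A ij.1 ij.2|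

/-- The Euclidean norm of a vector. -/
def l2Norm {n : ℕ} (v : Fin n → ℝ) : ℝ :=
  Real.sqrt (∑ j, v j ^ 2)

/-- The largest absolute value of a component of a vector. -/
def linftyNorm {m : ℕ} (v : Fin m → ℝ) : ℝ :=
  ⨆ i, |v i|

/-! Dependency graphs and forest complexity -/

/-- `G` is a dependency graph of the random variables `X v`: the families indexed by two disjoint,
non-adjacent sets of vertices are independent. -/
def IsDependencyGraph {V Ω β : Type*} [MeasurableSpace Ω] [MeasurableSpace β]
    (G : SimpleGraph V) (X : V → Ω → β) (μ : Measure Ω) : Prop :=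
  ∀ S T : Finset V, Disjoint S T → (∀ u ∈ S, ∀ v ∈ T, ¬ G.Adj u v) →
    IndepFun (fun ω (i : S) => X i ω) (fun ω (i : T) => X i ω) μ

/-- `(φ, F)` is a forest approximation of `G`. -/
structure IsForestApprox {V W : Type*} (G : SimpleGraph V) (F : SimpleGraph W) (φ : V → W) :
    Prop where
  isAcyclic : F.IsAcyclic
  map_adj : ∀ u v, G.Adj u v → φ u = φ v ∨ F.Adj (φ u) (φ v)

/-- The number of vertices that `φ` merges into `w`. -/
def fiberCard {V W : Type*} (φ : V → W) (w : W) : ℕ :=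
  (φ ⁻¹' {w}).ncard

open Classical in
/-- `λ_(φ,F)`: the sum over the edges `⟨u,v⟩` of `F` of `(|φ⁻¹(u)| + |φ⁻¹(v)|)²`, plus the sum over
the trees (connected components) `T` of `F` of `min_{u ∈ T} |φ⁻¹(u)|²`. -/
def forestWeight {V W : Type*} [Fintype W] (F : SimpleGraph W) (φ : V → W) : ℕ :=
  (∑ e ∈ F.edgeFinset,
      Sym2.lift ⟨fun u v => (fiberCard φ u + fiberCard φ v) ^ 2, fun u v => by
        simp only [add_comm]⟩ e)
    + ∑ T : F.ConnectedComponent, ⨅ u : T.supp, fiberCard φ (u : W) ^ 2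

/-- The forest complexity `Λ(G)`: the least weight of a forest approximation of `G` (by a finite
forest; its vertices may be taken to be `0, …, N - 1`). -/
def forestComplexity {V : Type*} (G : SimpleGraph V) : ℕ :=
  sInf {l : ℕ | ∃ (N : ℕ) (F : SimpleGraph (Fin N)) (φ : V → Fin N),
    IsForestApprox G F φ ∧ l = forestWeight F φ}

end

/-! If `P_distr` is infeasible the bound is `⊤`. Otherwise let `y` be optimal for it and give the
`k`-th sampled column the weight `y_{j_k} / (K ξ_{j_k})`. The vector `w` induced on `[n]` is a
sample mean of the vectors `(y_t / ξ_t) e_t`, whose expectation is `y` and whose norms are at most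
`C`. In general `A w ≠ b`, so `w` is not a feasible point; duality pays for the violation. When
`P_J` is feasible of full row rank, it has a dual feasible basis with solution `p` and `v(P_J) ≤
pᵀb` (`exists_optimal_dual_basis`). Dual feasibility on the sampled columns gives `pᵀb ≤ cᵀy + c̄ᵀ(w
- y)` (`exists_basis_optValue_sampled_le`). By Cauchy–Schwarz only `‖w - y‖₂` (for (ii)), together
with `‖A(w - y)‖₂` (for (i)), has to be controlled. These norms do not involve the basis, so no
union over bases is needed although the basis depends on the sample.

Both norms are handled by `IsDependencyGraph.sampleMean_deviation`. The mean deviation is at most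
the root of the second moment, where only diagonal and adjacent pairs contribute, whence `K +
2|E(G)|`. Fluctuations around it obey a McDiarmid inequality with `Λ(G)` in place of the number of
variables. For that, the variables are merged along an optimal forest approximation, each tree is
rooted at a vertex of smallest fibre, and vertices are eliminated from the leaves up with
Hoeffding's lemma (`weightedSum_exp_le`). A vertex costs the square of its own fibre plus its
parent's, and these costs sum to at most the forest weight (`SimpleGraph.IsAcyclic.exists_depth`).
-/

/-! ### Linear programming duality and dual feasible bases. -/

/-- Induction on the constraints. If `α a` is redundant it gets multiplier `0`. Otherwise some `y`
satisfies the other constraints with `γ y > 0`, which forces `α a y > 0`; composing all functionals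
with the projection along `y` onto `ker (α a)` eliminates `a`. The multiplier of `a` is then read
off by evaluating at `y`, and is nonnegative because `α i y ≤ 0` for the other `i`. -/
theorem farkas {W ι : Type*} [AddCommGroup W] [Module ℝ W] (s : Finset ι)
    (α : ι → Module.Dual ℝ W) (γ : Module.Dual ℝ W)
    (h : ∀ x, (∀ i ∈ s, α i x ≤ 0) → γ x ≤ 0) :
    ∃ l : ι → ℝ, (∀ i, 0 ≤ l i) ∧ γ = ∑ i ∈ s, l i • α i := by
  classical
  induction s using Finset.induction_on generalizing α γ with
  | empty =>
    refine ⟨0, fun _ => le_rfl, ?_⟩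
    ext x
    have h1 := h x (by simp)
    have h2 := h (-x) (by simp)
    simp only [map_neg] at h2
    simp only [Finset.sum_empty, LinearMap.zero_apply]
    linarith
  | insert a s ha ih =>
    by_cases hs : ∀ x, (∀ i ∈ s, α i x ≤ 0) → γ x ≤ 0
    · obtain ⟨l, hl, hγ⟩ := ih α γ hs
      refine ⟨Function.update l a 0, fun i => ?_, ?_⟩
      · by_cases hi : i = a
        · simp [hi]
        · simp [hi, hl]
      · rw [Finset.sum_insert ha, hγ]
        simp only [Function.update_self, zero_smul, zero_add]
        refine Finset.sum_congr rfl fun i hi => ?_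
        rw [Function.update_of_ne (ne_of_mem_of_not_mem hi ha)]
    · push Not at hs
      obtain ⟨y, hy, hγy⟩ := hs
      have hay : 0 < α a y := by
        by_contra hc
        refine absurd (h y fun i hi => ?_) (not_le.2 hγy)
        rcases Finset.mem_insert.1 hi with rfl | hi
        · exact not_lt.1 hc
        · exact hy i hi
      obtain ⟨l, hl, hγ⟩ := ih (fun i => α i - (α i y / α a y) • α a)
        (γ - (γ y / α a y) • α a) (fun x hx => by
          have := h (x - (α a x / α a y) • y) (fun i hi => by
            rcases Finset.mem_insert.1 hi with rfl | hi
            · simp [div_mul_cancel₀ _ hay.ne']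
            · have := hx i hi
              simp only [LinearMap.sub_apply, LinearMap.smul_apply, smul_eq_mul, map_sub,
                map_smul] at this ⊢
              convert this using 2
              ring)
          simp only [LinearMap.sub_apply, LinearMap.smul_apply, smul_eq_mul, map_sub,
            map_smul] at this ⊢
          convert this using 2
          ring)
      refine ⟨Function.update l a (γ y / α a y - ∑ i ∈ s, l i * (α i y / α a y)),
        fun i => ?_, ?_⟩
      · by_cases hi : i = a
        · simp only [hi, Function.update_self, sub_nonneg]
          refine (Finset.sum_nonpos fun i hi => ?_).trans (div_pos hγy hay).le
          exact mul_nonpos_of_nonneg_of_nonpos (hl i)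
            (div_nonpos_of_nonpos_of_nonneg (hy i hi) hay.le)
        · simp [hi, hl]
      · rw [Finset.sum_insert ha, Function.update_self]
        have : ∑ i ∈ s, Function.update l a
            (γ y / α a y - ∑ i ∈ s, l i * (α i y / α a y)) i • α i = ∑ i ∈ s, l i • α i :=
          Finset.sum_congr rfl fun i hi => by
            rw [Function.update_of_ne (ne_of_mem_of_not_mem hi ha)]
        rw [this]
        rw [sub_eq_iff_eq_add] at hγ
        conv_lhs => rw [hγ]
        simp only [smul_sub, Finset.sum_sub_distrib, smul_smul, ← Finset.sum_smul]
        module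

theorem dotProduct_col_combination {m K : ℕ} (M : Matrix (Fin m) (Fin K) ℝ) (x : Fin K → ℝ)
    (p : Fin m → ℝ) : p ⬝ᵥ M *ᵥ x = ∑ k, (p ᵥ* M) k * x k := by
  rw [dotProduct_mulVec]; rfl

/-- Strong duality for standard form problems: a strict lower bound on the primal objective is
beaten by some dual feasible solution. -/
theorem exists_dual_gt {m K : ℕ} (M : Matrix (Fin m) (Fin K) ℝ) (b : Fin m → ℝ) (d : Fin K → ℝ)
    (v : ℝ) (hne : (stdFeasible M b).Nonempty) (hv : ∀ x ∈ stdFeasible M b, v < d ⬝ᵥ x) :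
    ∃ p : Fin m → ℝ, p ᵥ* M ≤ d ∧ v < p ⬝ᵥ b := by
  by_contra! hcon
  -- Farkas is applied to the homogenised dual in `(u, τ)`, with `p = -u / τ`: the constraints are
  -- `τ ≥ 0` and `uᵀM + τ d ≥ 0`, the consequence is `bᵀu + v τ ≥ 0`. The multipliers of the columns
  -- form a primal feasible `x` with `dᵀx ≤ v`.
  let col : Option (Fin K) → Module.Dual ℝ ((Fin m → ℝ) × ℝ) := fun o => match o with
    | none => -LinearMap.snd ℝ _ _
    | some k => -((LinearMap.proj k ∘ₗ M.vecMulLinear) ∘ₗ LinearMap.fst ℝ _ _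
        + d k • LinearMap.snd ℝ _ _)
  let γ : Module.Dual ℝ ((Fin m → ℝ) × ℝ) :=
    -((dotProductBilin ℝ ℝ b) ∘ₗ LinearMap.fst ℝ _ _ + v • LinearMap.snd ℝ _ _)
  obtain ⟨l, hl, hγ⟩ := farkas Finset.univ col γ (by
    rintro ⟨u, τ⟩ h
    have h0 : 0 ≤ τ := by simpa [col] using h none (Finset.mem_univ _)
    have h1 : ∀ k, 0 ≤ (u ᵥ* M) k + d k * τ := fun k => by
      have := h (some k) (Finset.mem_univ _)
      simp only [col, LinearMap.neg_apply, LinearMap.add_apply, LinearMap.comp_apply,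
        LinearMap.fst_apply, LinearMap.smul_apply, LinearMap.snd_apply, smul_eq_mul,
        LinearMap.proj_apply, Matrix.vecMulLinear_apply] at this
      linarith
    -- At `τ = 0` there is no dual point to rescale to; primal feasibility is used instead.
    have h2 : 0 ≤ b ⬝ᵥ u + v * τ := by
      rcases h0.eq_or_lt with rfl | hτ
      · obtain ⟨x, hx, hx0⟩ := hne
        rw [dotProduct_comm, ← hx, dotProduct_col_combination]
        simp only [mul_zero, add_zero] at h1 ⊢
        exact Finset.sum_nonneg fun k _ => mul_nonneg (h1 k) (hx0 k)
      · have := hcon (-(τ⁻¹ • u)) (fun k => by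
          have := h1 k
          simp only [neg_vecMul, smul_vecMul, Pi.neg_apply, Pi.smul_apply, smul_eq_mul]
          rw [neg_le, le_inv_mul_iff₀ hτ]
          linarith)
        rw [neg_dotProduct, smul_dotProduct, smul_eq_mul, neg_le, le_inv_mul_iff₀ hτ] at this
        rw [dotProduct_comm]
        linarith
    simp only [γ, LinearMap.neg_apply, LinearMap.add_apply, LinearMap.comp_apply,
        LinearMap.fst_apply, LinearMap.smul_apply, LinearMap.snd_apply, smul_eq_mul,
        dotProductBilin_apply_apply]
    linarith)
  let x : Fin K → ℝ := fun k => l (some k)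
  have key : ∀ u τ, b ⬝ᵥ u + v * τ = ∑ k, x k * ((u ᵥ* M) k + d k * τ) + l none * τ := by
    intro u τ
    have := congrArg (fun f => f (u, τ)) hγ
    simp only [γ, col, LinearMap.neg_apply, LinearMap.add_apply, LinearMap.comp_apply,
        LinearMap.fst_apply, LinearMap.smul_apply, LinearMap.snd_apply, smul_eq_mul,
        dotProductBilin_apply_apply, LinearMap.sum_apply, Fintype.sum_option, mul_neg,
        Finset.sum_neg_distrib, LinearMap.proj_apply, Matrix.vecMulLinear_apply] at this
    simp only [x]
    linarith
  have hx : x ∈ stdFeasible M b := by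
    refine ⟨dotProduct_eq _ _ fun u => ?_, fun k => hl _⟩
    have := key u 0
    simp only [mul_zero, add_zero] at this
    rw [this, dotProduct_comm, dotProduct_col_combination]
    exact Finset.sum_congr rfl fun k _ => mul_comm _ _
  have h3 := hv x hx
  have h4 := key 0 1
  simp only [dotProduct_zero, mul_one, zero_add, zero_vecMul, Pi.zero_apply] at h4
  have h5 : d ⬝ᵥ x = ∑ k, x k * d k := Finset.sum_congr rfl fun k _ => mul_comm _ _
  have := hl none
  linarith

theorem isLPBasis_of_tight {m K : ℕ} (M : Matrix (Fin m) (Fin K) ℝ) (d : Fin K → ℝ)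
    (p : Fin m → ℝ) (B : Fin m → Fin K) (hB : IsLPBasis M B)
    (hp : ∀ i, (p ᵥ* M) (B i) = d (B i)) : dualBasicSolution M d B = p := by
  have : d ∘ B = p ᵥ* M.submatrix id B := by
    ext i
    exact (hp i).symm
  rw [dualBasicSolution, this, vecMul_vecMul, Matrix.mul_nonsing_inv _ hB, vecMul_one]

theorem exists_basis_of_span {m K : ℕ} (M : Matrix (Fin m) (Fin K) ℝ) (T : Set (Fin K))
    (hT : Submodule.span ℝ (Set.range fun k : T => M.col k) = ⊤) :
    ∃ B : Fin m → Fin K, IsLPBasis M B ∧ ∀ i, B i ∈ T := by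
  obtain ⟨κ, a, -, hspan, hli⟩ := exists_linearIndependent' ℝ (fun k : T => M.col k)
  let bas := Module.Basis.mk hli (by rw [hspan, hT])
  have : Finite κ := Module.Finite.finite_basis bas
  have hcard : Nat.card κ = m := by
    rw [← Module.finrank_eq_nat_card_basis bas]; simp
  let e : Fin m ≃ κ := (Finite.equivFinOfCardEq hcard).symm
  refine ⟨fun i => a (e i), ?_, fun i => (a (e i)).2⟩
  rw [IsLPBasis, ← Matrix.isUnit_iff_isUnit_det, ← Matrix.linearIndependent_cols_iff_isUnit]
  exact hli.comp e e.injective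

theorem eq_zero_of_vecMul_eq_zero {m K : ℕ} (M : Matrix (Fin m) (Fin K) ℝ) (hM : M.rank = m)
    (u : Fin m → ℝ) (hu : u ᵥ* M = 0) : u = 0 := by
  have htop : LinearMap.range M.mulVecLin = ⊤ := by
    apply Submodule.eq_top_of_finrank_eq
    rw [← Matrix.rank, hM]; simp
  refine dotProduct_eq _ _ fun v => ?_
  obtain ⟨x, rfl⟩ : v ∈ LinearMap.range M.mulVecLin := htop ▸ Submodule.mem_top
  rw [Matrix.mulVecLin_apply, dotProduct_mulVec, hu, zero_dotProduct, zero_dotProduct]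

/-- A direction that keeps the tight constraints tight, does not decrease the dual objective and
runs into some other constraint. -/
theorem exists_dual_direction {m K : ℕ} (M : Matrix (Fin m) (Fin K) ℝ) (hM : M.rank = m)
    (b : Fin m → ℝ) (hne : (stdFeasible M b).Nonempty) (T : Set (Fin K))
    (hT : Submodule.span ℝ (Set.range fun k : T => M.col k) ≠ ⊤) :
    ∃ u : Fin m → ℝ, (∀ k ∈ T, (u ᵥ* M) k = 0) ∧ 0 ≤ u ⬝ᵥ b ∧ ∃ k, 0 < (u ᵥ* M) k := by
  obtain ⟨f, hf0, hf⟩ := Submodule.exists_le_ker_of_lt_top _ (lt_top_iff_ne_top.2 hT)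
  obtain ⟨u, rfl⟩ := (dotProductEquiv ℝ (Fin m)).surjective f
  have hu0 : u ≠ 0 := by rintro rfl; exact hf0 (map_zero _)
  have huT : ∀ k ∈ T, (u ᵥ* M) k = 0 := fun k hk =>
    hf (Submodule.subset_span ⟨⟨k, hk⟩, rfl⟩)
  have huM : ∃ k, (u ᵥ* M) k ≠ 0 := by
    by_contra! h
    exact hu0 (eq_zero_of_vecMul_eq_zero M hM u (funext h))
  have hpos : ∀ w : Fin m → ℝ, 0 < w ⬝ᵥ b → ∃ k, 0 < (w ᵥ* M) k := by
    intro w hw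
    obtain ⟨x, hx, hx0⟩ := hne
    rw [← hx, dotProduct_col_combination] at hw
    by_contra! h
    exact absurd hw (not_lt.2 (Finset.sum_nonpos fun k _ =>
      mul_nonpos_of_nonpos_of_nonneg (h k) (hx0 k)))
  have hneg : ∀ k ∈ T, ((-u) ᵥ* M) k = 0 := fun k hk => by
    rw [neg_vecMul, Pi.neg_apply, huT k hk, neg_zero]
  -- The sign of `u` is chosen to make the objective increase. If the objective is constant along
  -- `u`, the sign is free and is chosen so that a nonzero entry of `uᵀM`, which exists by full
  -- rank, becomes positive.
  rcases lt_trichotomy (u ⬝ᵥ b) 0 with h | h | h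
  · have h' : 0 < (-u) ⬝ᵥ b := by rw [neg_dotProduct]; linarith
    exact ⟨-u, hneg, h'.le, hpos _ h'⟩
  · obtain ⟨k, hk⟩ := huM
    rcases hk.lt_or_gt with hk | hk
    · refine ⟨-u, hneg, by simp [h], k, ?_⟩
      rw [neg_vecMul, Pi.neg_apply]; linarith
    · exact ⟨u, huT, h.ge, k, hk⟩
  · exact ⟨u, huT, h.le, hpos _ h⟩

/-- Every dual feasible solution is dominated by a dual feasible basic solution. -/
theorem exists_basic_dual_ge {m K : ℕ} (M : Matrix (Fin m) (Fin K) ℝ) (hM : M.rank = m)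
    (b : Fin m → ℝ) (hne : (stdFeasible M b).Nonempty) (d : Fin K → ℝ)
    (p : Fin m → ℝ) (hp : p ᵥ* M ≤ d) :
    ∃ B : Fin m → Fin K, IsLPBasis M B ∧ dualBasicSolution M d B ᵥ* M ≤ d ∧
      p ⬝ᵥ b ≤ dualBasicSolution M d B ⬝ᵥ b := by
  -- Induction on the number of slack constraints. If the tight columns span, they contain a basis
  -- and `p` is its basic solution; otherwise moving along a dual direction makes one more
  -- constraint tight.
  induction hN : K - {k | (p ᵥ* M) k = d k}.ncard using Nat.strong_induction_on
    generalizing p with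
  | _ N ih =>
  set T : Set (Fin K) := {k | (p ᵥ* M) k = d k} with hTdef
  by_cases hT : Submodule.span ℝ (Set.range fun k : T => M.col k) = ⊤
  · obtain ⟨B, hB, hBT⟩ := exists_basis_of_span M T hT
    refine ⟨B, hB, ?_⟩
    rw [isLPBasis_of_tight M d p B hB hBT]
    exact ⟨hp, le_rfl⟩
  · obtain ⟨u, huT, hub, k₁, hk₁⟩ := exists_dual_direction M hM b hne T hT
    -- Ratio test: `t` is the largest step that keeps dual feasibility, and `k₀` is a constraint
    -- that becomes tight.
    obtain ⟨k₀, hk₀, hmin⟩ := (Finset.univ.filter fun k => 0 < (u ᵥ* M) k).exists_min_image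
      (fun k => (d k - (p ᵥ* M) k) / (u ᵥ* M) k) ⟨k₁, by simpa using hk₁⟩
    simp only [Finset.mem_filter, Finset.mem_univ, true_and] at hk₀ hmin
    set t := (d k₀ - (p ᵥ* M) k₀) / (u ᵥ* M) k₀ with ht
    have ht0 : 0 ≤ t := div_nonneg (sub_nonneg.2 (hp k₀)) hk₀.le
    have hp' : ∀ k, ((p + t • u) ᵥ* M) k = (p ᵥ* M) k + t * (u ᵥ* M) k := fun k => by
      rw [add_vecMul, smul_vecMul]; rfl
    have hfeas : (p + t • u) ᵥ* M ≤ d := fun k => by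
      rw [hp']
      rcases lt_or_ge 0 ((u ᵥ* M) k) with hk | hk
      · have := (le_div_iff₀ hk).1 (hmin k hk)
        linarith
      · have := mul_nonpos_of_nonneg_of_nonpos ht0 hk
        linarith [hp k]
    have hlt : T.ncard < {k | ((p + t • u) ᵥ* M) k = d k}.ncard := by
      refine Set.ncard_lt_ncard (Set.ssubset_iff_of_subset (fun k hk => ?_) |>.2 ⟨k₀, ?_, ?_⟩)
        (Set.toFinite _)
      · rw [Set.mem_ofPred_eq, hp', huT k hk, mul_zero, add_zero]
        exact hk
      · rw [Set.mem_ofPred_eq, hp', ht, div_mul_cancel₀ _ hk₀.ne']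
        ring
      · exact fun h => hk₀.ne' (huT k₀ h)
    have hle : {k | ((p + t • u) ᵥ* M) k = d k}.ncard ≤ K := by
      simpa using Set.ncard_le_card {k | ((p + t • u) ᵥ* M) k = d k}
    obtain ⟨B, hB, hBd, hBb⟩ := ih _ (by omega) (p + t • u) hfeas rfl
    refine ⟨B, hB, hBd, le_trans ?_ hBb⟩
    rw [add_dotProduct, smul_dotProduct, smul_eq_mul]
    have := mul_nonneg ht0 hub
    linarith

/-- A feasible and bounded standard form problem of full row rank has a dual feasible basis whose
dual value bounds the optimal value from above. -/
theorem exists_optimal_dual_basis {m K : ℕ} (M : Matrix (Fin m) (Fin K) ℝ) (hM : M.rank = m)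
    (b : Fin m → ℝ) (d : Fin K → ℝ) (hne : (stdFeasible M b).Nonempty)
    (hbdd : BddBelow ((fun x => d ⬝ᵥ x) '' stdFeasible M b)) :
    ∃ B : Fin m → Fin K, IsLPBasis M B ∧ dualBasicSolution M d B ᵥ* M ≤ d ∧
      optValue d (stdFeasible M b) ≤ ((dualBasicSolution M d B ⬝ᵥ b : ℝ) : EReal) := by
  obtain ⟨L, hL⟩ := hbdd
  obtain ⟨p, hp, -⟩ := exists_dual_gt M b d (L - 1) hne fun x hx => by
    have := hL ⟨x, hx, rfl⟩
    simp only at this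
    linarith
  obtain ⟨B₀, hB₀, hB₀d, -⟩ := exists_basic_dual_ge M hM b hne d p hp
  -- There are finitely many bases, so a best dual feasible one exists. A duality gap at it would
  -- give a better dual point, hence a better basis.
  obtain ⟨B, ⟨hB, hBd⟩, hmax⟩ := Set.exists_max_image
    {B : Fin m → Fin K | IsLPBasis M B ∧ dualBasicSolution M d B ᵥ* M ≤ d}
    (fun B => dualBasicSolution M d B ⬝ᵥ b) (Set.toFinite _) ⟨B₀, hB₀, hB₀d⟩
  refine ⟨B, hB, hBd, ?_⟩
  by_contra! hlt
  obtain ⟨q, hq, hqb⟩ := exists_dual_gt M b d (dualBasicSolution M d B ⬝ᵥ b) hne fun x hx =>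
    EReal.coe_lt_coe_iff.1 (hlt.trans_le (iInf₂_le x hx))
  obtain ⟨B', hB', hB'd, hB'b⟩ := exists_basic_dual_ge M hM b hne d q hq
  exact absurd (hmax B' ⟨hB', hB'd⟩) (not_le.2 (hqb.trans_le hB'b))

/-! ### Exponential moments of functions of forest-dependent variables. -/

/-- The weights are turned into a discrete probability measure, so that Hoeffding's lemma applies to
the centred variable; the mean is then put back as the factor `exp (s * e)`. -/
theorem hoeffding_lemma_sum {β : Type*} [Fintype β] (q h : β → ℝ) (hq : ∀ x, 0 ≤ q x)
    (hq1 : ∑ x, q x = 1) (a c : ℝ) (hh : ∀ x, h x ∈ Set.Icc a (a + c)) (s : ℝ) :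
    ∑ x, q x * Real.exp (s * h x) ≤ Real.exp (s * ∑ x, q x * h x + s ^ 2 / 8 * c ^ 2) := by
  let _ : MeasurableSpace β := ⊤
  have hint : ∀ (g : β → ℝ), ∫ x, g x ∂(∑ x, ENNReal.ofReal (q x) • Measure.dirac x) =
      ∑ x, q x * g x := fun g => by
    rw [integral_finsetSum_measure]
    · refine Finset.sum_congr rfl fun x _ => ?_
      rw [integral_smul_measure, integral_dirac, ENNReal.toReal_ofReal (hq x), smul_eq_mul]
    · intro x _
      exact (integrable_dirac (by simp)).smul_measure ENNReal.ofReal_ne_top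
  set ν : Measure β := ∑ x, ENNReal.ofReal (q x) • Measure.dirac x with hν
  have : IsProbabilityMeasure ν := ⟨by
    rw [hν]
    simp only [Measure.coe_finsetSum, Finset.sum_apply, Measure.smul_apply, measure_univ,
      smul_eq_mul, mul_one]
    rw [← ENNReal.ofReal_sum_of_nonneg fun x _ => hq x, hq1, ENNReal.ofReal_one]⟩
  have key := (hasSubgaussianMGF_of_mem_Icc (μ := ν) (X := h) (a := a) (b := a + c)
    (measurable_from_top).aemeasurable (ae_of_all _ hh)).mgf_le s
  rw [mgf, hint, hint] at key
  set e := ∑ x, q x * h x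
  have hc : 0 ≤ c := by
    have : Nonempty β := by
      by_contra hne
      rw [not_nonempty_iff] at hne
      simp at hq1
    have := hh (Classical.arbitrary β)
    linarith [this.1.trans this.2]
  calc ∑ x, q x * Real.exp (s * h x)
      = Real.exp (s * e) * ∑ x, q x * Real.exp (s * (h x - e)) := by
        rw [Finset.mul_sum]
        refine Finset.sum_congr rfl fun x _ => ?_
        rw [mul_sub, sub_eq_add_neg, Real.exp_add, Real.exp_neg]
        field_simp
    _ ≤ Real.exp (s * e) * Real.exp (s ^ 2 / 8 * c ^ 2) := by
        refine mul_le_mul_of_nonneg_left (key.trans (le_of_eq ?_)) (Real.exp_pos _).le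
        congr 1
        simp only [add_sub_cancel_left, NNReal.coe_pow, NNReal.coe_div, coe_nnnorm,
          Real.norm_eq_abs, NNReal.coe_ofNat, div_pow, sq_abs]
        ring
    _ = _ := (Real.exp_add _ _).symm

/-- The expectation of `f` under the weights `P`. -/
def weightedSum {X : Type*} [Fintype X] (P f : X → ℝ) : ℝ :=
  ∑ y, P y * f y

section weightedSum

variable {X : Type*} [Fintype X] {P : X → ℝ}

theorem weightedSum_mono (hP : ∀ y, 0 ≤ P y) {f g : X → ℝ} (h : ∀ y, f y ≤ g y) :
    weightedSum P f ≤ weightedSum P g :=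
  Finset.sum_le_sum fun y _ => mul_le_mul_of_nonneg_left (h y) (hP y)

theorem weightedSum_add_const (hP : ∑ y, P y = 1) (f : X → ℝ) (c : ℝ) :
    weightedSum P (fun y => f y + c) = weightedSum P f + c := by
  simp only [weightedSum, mul_add, Finset.sum_add_distrib, ← Finset.sum_mul, hP, one_mul]

theorem weightedSum_div (f : X → ℝ) (g : X → ℝ) (q : ℝ) :
    weightedSum (fun y => P y * g y / q) f = weightedSum P (fun y => g y * f y) / q := by
  simp only [weightedSum, Finset.sum_div]
  refine Finset.sum_congr rfl fun y _ => ?_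
  ring

end weightedSum

/-- Under the weights `P`, functions of coordinates in disjoint sets `A, B ⊆ S` that are not joined
by an edge of `F` are uncorrelated. -/
def FactorizesOn {W β : Type*} [Fintype W] [DecidableEq W] [Fintype β] (F : SimpleGraph W) (S : Finset W)
    (P : (W → β) → ℝ) : Prop :=
  ∀ A B : Finset W, A ⊆ S → B ⊆ S → Disjoint A B → (∀ u ∈ A, ∀ v ∈ B, ¬ F.Adj u v) →
    ∀ g h : (W → β) → ℝ, DependsOn g (A : Set W) → DependsOn h (B : Set W) →
      weightedSum P (fun y => g y * h y) = weightedSum P g * weightedSum P h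

section boundedDifferences

variable {W β : Type*} [DecidableEq W]

/-- Changing the coordinate `i` increases `f` by at most `c i`. -/
def BoundedDifferences (f : (W → β) → ℝ) (c : W → ℝ) : Prop :=
  ∀ y i b, f (Function.update y i b) ≤ f y + c i

theorem BoundedDifferences.piecewise_le {f : (W → β) → ℝ} {c : W → ℝ}
    (hf : BoundedDifferences f c) (N : Finset W) (y z : W → β) :
    f (N.piecewise z y) ≤ f y + ∑ i ∈ N, c i := by
  induction N using Finset.induction_on with
  | empty => simp
  | insert i N hi ih =>
    rw [Finset.piecewise_insert, Finset.sum_insert hi]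
    linarith [hf (N.piecewise z y) i (z i)]

variable [Fintype W] [Fintype β]

/-- A function with bounded differences is pinned from below, up to the sum of the bounds, by a
function of the remaining coordinates. -/
theorem BoundedDifferences.exists_lower {f : (W → β) → ℝ} {c : W → ℝ}
    (hf : BoundedDifferences f c) {S : Finset W} (hS : DependsOn f (S : Set W)) (N : Finset W) :
    ∃ g : (W → β) → ℝ, DependsOn g ((S \ N : Finset W) : Set W) ∧ (∀ y, g y ≤ f y) ∧
      ∀ y, f y ≤ g y + ∑ i ∈ N, c i := by
  -- The lower function is the infimum of `f` over the coordinates in `N`.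
  refine ⟨fun y => ⨅ z, f (N.piecewise z y), fun y y' hy => ?_, fun y => ?_, fun y => ?_⟩
  · refine congrArg _ (funext fun z => hS fun i hi => ?_)
    by_cases hiN : i ∈ N
    · simp [hiN]
    · simp only [hiN, not_false_eq_true, Finset.piecewise_eq_of_notMem]
      exact hy i (by simpa [hiN] using hi)
  · refine (ciInf_le (Set.finite_range _).bddBelow y).trans (le_of_eq (congrArg f ?_))
    ext i; simp [Finset.piecewise]
  · have : Nonempty (W → β) := ⟨y⟩
    rw [← sub_le_iff_le_add]
    refine le_ciInf fun z => ?_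
    have := hf.piecewise_le N (N.piecewise z y) y
    have h2 : N.piecewise y (N.piecewise z y) = y := by
      ext i; by_cases hi : i ∈ N <;> simp [hi]
    rw [h2] at this
    linarith

end boundedDifferences

theorem dependsOn_indicator {W β : Type*} [DecidableEq β] (i : W) (x : β) (A : Finset W) (hi : i ∈ A) :
    DependsOn (fun y : W → β => if y i = x then (1 : ℝ) else 0) (A : Set W) := fun y y' h => by
  simp only [h i (Finset.mem_coe.2 hi)]

section forest

variable {W β : Type*} [Fintype W] [DecidableEq W] [Fintype β] [DecidableEq β]

/-- The weights `P` conditioned on `y i = x`. -/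
noncomputable def condWeight (P : (W → β) → ℝ) (i : W) (x : β) (y : W → β) : ℝ :=
  P y * (if y i = x then 1 else 0) / weightedSum P (fun y => if y i = x then 1 else 0)

theorem weightedSum_condWeight (P f : (W → β) → ℝ) (i : W) (x : β) :
    weightedSum (condWeight P i x) f =
      weightedSum P (fun y => (if y i = x then 1 else 0) * f y) /
        weightedSum P (fun y => if y i = x then 1 else 0) :=
  weightedSum_div _ _ _

/-- If `i` is not adjacent to `A`, conditioning on `y i` does not change the law on `A`. -/
theorem FactorizesOn.weightedSum_condWeight_eq {F : SimpleGraph W} {S : Finset W}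
    {P : (W → β) → ℝ} (hP : FactorizesOn F S P) {i : W} (hi : i ∈ S) {A : Finset W} (hA : A ⊆ S)
    (hiA : i ∉ A) (hadj : ∀ u ∈ A, ¬ F.Adj i u) {x : β}
    (hx : weightedSum P (fun y => if y i = x then 1 else 0) ≠ 0)
    {g : (W → β) → ℝ} (hg : DependsOn g (A : Set W)) :
    weightedSum (condWeight P i x) g = weightedSum P g := by
  rw [weightedSum_condWeight, hP {i} A (by simpa) hA (by simpa) (by simpa) _ _
    (dependsOn_indicator i x _ (by simp)) hg, mul_div_cancel_left₀ _ hx]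

/-- Since `i` has at most one neighbour in `S`, one of two disjoint sets `A`, `B` has no neighbour
of `i`. That set is still separated from the other one enlarged by `i`, so the indicator of `y i =
x` can be absorbed into the function on the other side. -/
theorem FactorizesOn.condWeight {F : SimpleGraph W} {S : Finset W} {P : (W → β) → ℝ} {i : W}
    (hP : FactorizesOn F (insert i S) P) (hi : i ∉ S)
    (hsub : {u | u ∈ S ∧ F.Adj i u}.Subsingleton) {x : β}
    (hx : weightedSum P (fun y => if y i = x then 1 else 0) ≠ 0) :
    FactorizesOn F S (condWeight P i x) := by
  have key : ∀ A B : Finset W, A ⊆ S → B ⊆ S → Disjoint A B →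
      (∀ u ∈ A, ∀ v ∈ B, ¬ F.Adj u v) → (∀ u ∈ A, ¬ F.Adj i u) →
      ∀ g h : (W → β) → ℝ, DependsOn g (A : Set W) → DependsOn h (B : Set W) →
        weightedSum (_root_.condWeight P i x) (fun y => g y * h y) =
          weightedSum (_root_.condWeight P i x) g * weightedSum (_root_.condWeight P i x) h := by
    intro A B hA hB hAB hadj hiA g h hg hh
    have hA' := hA.trans (Finset.subset_insert i S)
    have hiA' : i ∉ A := fun h => hi (hA h)
    rw [hP.weightedSum_condWeight_eq (Finset.mem_insert_self i S) hA' hiA' hiA hx hg,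
      weightedSum_condWeight, weightedSum_condWeight, ← mul_div_assoc,
      ← hP A (insert i B) hA' (Finset.insert_subset_insert i hB) (by simp [hiA', hAB]) _ _ _ hg _]
    · congr 2
      ext y
      ring
    · intro u hu v hv
      rcases Finset.mem_insert.1 hv with rfl | hv
      · exact fun h => hiA u hu h.symm
      · exact hadj u hu v hv
    · intro y y' hy
      have h1 := hy i (by simp)
      have h2 := hh (fun j hj => hy j (by simp [Finset.mem_coe.1 hj]))
      simp only [h1, h2]
  intro A B hA hB hAB hadj g h hg hh
  by_cases hiA : ∀ u ∈ A, ¬ F.Adj i u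
  · exact key A B hA hB hAB hadj hiA g h hg hh
  · have hiB : ∀ v ∈ B, ¬ F.Adj i v := by
      push Not at hiA
      obtain ⟨u, hu, hiu⟩ := hiA
      intro v hv hiv
      have : u = v := hsub ⟨hA hu, hiu⟩ ⟨hB hv, hiv⟩
      exact Finset.disjoint_left.1 hAB hu (this ▸ hv)
    have := key B A hB hA hAB.symm (fun u hu v hv h => hadj v hv u hu h.symm) hiB h g hh hg
    simp only [mul_comm] at this ⊢
    exact this

open Classical in
/-- Exponential moments of a function with bounded differences of variables whose dependencies
follow a forest: the vertices are eliminated by decreasing `depth`, each having at most one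
neighbour that is eliminated later. -/
theorem weightedSum_exp_le (F : SimpleGraph W) (depth : W → ℕ)
    (hdepth : ∀ v, {u | F.Adj v u ∧ depth u ≤ depth v}.Subsingleton) (c : W → ℝ)
    (hc : ∀ i, 0 ≤ c i) (s : ℝ) (S : Finset W) (P : (W → β) → ℝ) (hP : ∀ y, 0 ≤ P y)
    (hP1 : ∑ y, P y = 1) (hF : FactorizesOn F S P) (f : (W → β) → ℝ)
    (hfS : DependsOn f (S : Set W)) (hf : BoundedDifferences f c) :
    weightedSum P (fun y => Real.exp (s * f y)) ≤ Real.exp (s * weightedSum P f + s ^ 2 / 8 *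
      ∑ v ∈ S, (c v + ∑ u with F.Adj v u ∧ depth u ≤ depth v, c u) ^ 2) := by
  induction S using Finset.induction_on_max_value depth generalizing P f with
  | empty =>
    have hne : Nonempty (W → β) := by
      by_contra hne
      rw [not_nonempty_iff] at hne
      simp at hP1
    obtain ⟨y₀⟩ := hne
    have hconst : f = fun _ => f y₀ := funext fun y => hfS (by simp)
    rw [hconst]
    simp only [weightedSum, ← Finset.sum_mul, hP1, one_mul, Finset.sum_empty, mul_zero, add_zero,
      le_refl]
  | insert i S hi hmax ih =>
    set ind : β → (W → β) → ℝ := fun x y => if y i = x then 1 else 0 with hind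
    set q : β → ℝ := fun x => weightedSum P (ind x) with hq
    have hind0 : ∀ x y, 0 ≤ ind x y := fun x y => by
      simp only [hind]; split_ifs <;> norm_num
    have hq0 : ∀ x, 0 ≤ q x := fun x =>
      Finset.sum_nonneg fun y _ => mul_nonneg (hP y) (hind0 x y)
    have htotal : ∀ g : (W → β) → ℝ,
        ∑ x, weightedSum P (fun y => ind x y * g y) = weightedSum P g := fun g => by
      simp only [weightedSum]
      rw [Finset.sum_comm]
      refine Finset.sum_congr rfl fun y _ => ?_
      rw [← Finset.mul_sum, ← Finset.sum_mul]
      simp [hind]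
    have hq1 : ∑ x, q x = 1 := by
      have := htotal (fun _ => 1)
      simp only [mul_one] at this
      rw [this]
      simpa [weightedSum] using hP1
    -- `N` consists of `i` and its neighbours in `S`, of which there is at most one by `hdepth`. The
    -- lower function `g` lives off `N`, so conditioning on `y i` does not change its mean `m`;
    -- hence all conditional means of `f` lie in an interval of length `cN`, to which Hoeffding's
    -- lemma applies.
    set N : Finset W := insert i (S.filter (F.Adj i)) with hN
    obtain ⟨g, hgS, hgf, hfg⟩ := hf.exists_lower hfS N
    set cN := ∑ j ∈ N, c j with hcN
    have hcN0 : 0 ≤ cN := Finset.sum_nonneg fun j _ => hc j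
    have hcN_le : cN ≤ c i + ∑ u with F.Adj i u ∧ depth u ≤ depth i, c u := by
      rw [hcN, hN, Finset.sum_insert (by simp)]
      refine add_le_add le_rfl
        (Finset.sum_le_sum_of_subset_of_nonneg (fun u hu => ?_) fun j _ _ => hc j)
      rw [Finset.mem_filter] at hu
      simp [hu.2, hmax u hu.1]
    set W' := ∑ v ∈ S, (c v + ∑ u with F.Adj v u ∧ depth u ≤ depth v, c u) ^ 2 with hW'
    set m := weightedSum P g with hm
    -- The conditional mean of `f` given `y i = x`. Conditional weights on a null event are all `0`,
    -- so the value `m` is used there to stay in the interval.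
    set h : β → ℝ := fun x => if q x = 0 then m else weightedSum (condWeight P i x) f with hh
    have hcond0 : ∀ x y, 0 ≤ condWeight P i x y := fun x y =>
      div_nonneg (mul_nonneg (hP y) (hind0 x y)) (hq0 x)
    have hcond1 : ∀ x, q x ≠ 0 → ∑ y, condWeight P i x y = 1 := fun x hx => by
      have := weightedSum_condWeight P (fun _ => 1) i x
      simp only [weightedSum, mul_one] at this
      rw [this]
      exact div_self hx
    have hh_mem : ∀ x, h x ∈ Set.Icc m (m + cN) := fun x => by
      by_cases hx : q x = 0
      · simp [hh, hx, hcN0]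
      · have hgm : weightedSum (condWeight P i x) g = m :=
          hF.weightedSum_condWeight_eq (Finset.mem_insert_self i S) Finset.sdiff_subset
            (by simp [hN]) (fun u hu hadj => by
              simp only [hN, Finset.mem_sdiff, Finset.mem_insert, Finset.mem_filter] at hu
              rcases hu.1 with rfl | hu'
              · exact F.loopless.irrefl _ hadj
              · exact hu.2 (Or.inr ⟨hu', hadj⟩)) hx hgS
        simp only [hh, hx, if_false]
        constructor
        · rw [← hgm]
          exact weightedSum_mono (hcond0 x) hgf
        · rw [← hgm, ← weightedSum_add_const (hcond1 x hx)]
          exact weightedSum_mono (hcond0 x) hfg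
    have hstep : ∀ x, weightedSum P (fun y => ind x y * Real.exp (s * f y)) ≤
        q x * Real.exp (s * h x) * Real.exp (s ^ 2 / 8 * W') := fun x => by
      by_cases hx : q x = 0
      · have hz : ∀ y, P y * ind x y = 0 := fun y =>
          (Finset.sum_eq_zero_iff_of_nonneg fun y _ => mul_nonneg (hP y) (hind0 x y)).1 hx y
            (Finset.mem_univ y)
        rw [hx, zero_mul, zero_mul]
        refine (Finset.sum_eq_zero fun y _ => ?_).le
        rw [← mul_assoc, hz, zero_mul]
      -- Freezing coordinate `i` yields a function of `S` alone, as the induction hypothesis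
      -- requires; it agrees with `f` wherever the conditional weight is nonzero.
      · set fx : (W → β) → ℝ := fun y => f (Function.update y i x) with hfx
        have hrepl : ∀ k : ℝ → ℝ, weightedSum (condWeight P i x) (fun y => k (fx y)) =
            weightedSum (condWeight P i x) (fun y => k (f y)) := fun k => by
          refine Finset.sum_congr rfl fun y _ => ?_
          by_cases hy : y i = x
          · simp only [hfx, ← hy, Function.update_eq_self]
          · simp [condWeight, hy]
        have := ih (condWeight P i x) (hcond0 x) (hcond1 x hx)
          (hF.condWeight hi (fun u hu v hv => hdepth i ⟨hu.2, hmax u hu.1⟩ ⟨hv.2, hmax v hv.1⟩) hx)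
          fx (fun y y' hy => hfS fun j hj => by
            by_cases hji : j = i
            · subst hji; simp
            · simp only [ne_eq, hji, not_false_eq_true, Function.update_of_ne]
              exact hy j (by simpa [hji] using hj))
          (fun y j b => by
            by_cases hji : j = i
            · subst hji
              simp only [hfx, Function.update_idem]
              linarith [hc j]
            · simp only [hfx]
              rw [Function.update_comm hji]
              exact hf _ _ _)
        rw [hrepl (fun r => Real.exp (s * r)), hrepl (fun r => r), weightedSum_condWeight,
          div_le_iff₀ ((hq0 x).lt_of_ne' hx), Real.exp_add] at this
        simp only [hh, hx, if_false]
        calc _ ≤ _ := this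
          _ = _ := by ring
    have hmean : ∑ x, q x * h x = weightedSum P f := by
      rw [← htotal f]
      refine Finset.sum_congr rfl fun x _ => ?_
      by_cases hx : q x = 0
      · have hz : ∀ y, P y * ind x y = 0 := fun y =>
          (Finset.sum_eq_zero_iff_of_nonneg fun y _ => mul_nonneg (hP y) (hind0 x y)).1 hx y
            (Finset.mem_univ y)
        rw [hx, zero_mul]
        refine (Finset.sum_eq_zero fun y _ => ?_).symm
        rw [← mul_assoc, hz, zero_mul]
      · simp only [hh, hx, if_false]
        rw [weightedSum_condWeight]
        exact mul_div_cancel₀ _ hx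
    calc weightedSum P (fun y => Real.exp (s * f y))
        = ∑ x, weightedSum P (fun y => ind x y * Real.exp (s * f y)) := (htotal _).symm
      _ ≤ ∑ x, q x * Real.exp (s * h x) * Real.exp (s ^ 2 / 8 * W') :=
          Finset.sum_le_sum fun x _ => hstep x
      _ = (∑ x, q x * Real.exp (s * h x)) * Real.exp (s ^ 2 / 8 * W') :=
          (Finset.sum_mul _ _ _).symm
      _ ≤ Real.exp (s * ∑ x, q x * h x + s ^ 2 / 8 * cN ^ 2) * Real.exp (s ^ 2 / 8 * W') :=
          mul_le_mul_of_nonneg_right (hoeffding_lemma_sum q h hq0 hq1 m cN hh_mem s)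
            (Real.exp_pos _).le
      _ ≤ _ := by
          rw [← Real.exp_add, hmean, Finset.sum_insert hi, Real.exp_le_exp, add_assoc, ← mul_add]
          gcongr

end forest

/-! ### Rooting a forest and the cost of the elimination order. -/

section elimination

variable {W : Type*} {F : SimpleGraph W}

/-- In a forest the distance to `r` changes by exactly one along an edge, so a neighbour that is not
farther is the penultimate vertex of the unique path from `r` to `v`. -/
theorem SimpleGraph.IsAcyclic.closer_neighbor_unique (hF : F.IsAcyclic) {r v u₁ u₂ : W}
    (hr : F.Reachable r v) (h₁ : F.Adj v u₁) (h₂ : F.Adj v u₂)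
    (hd₁ : F.dist r u₁ ≤ F.dist r v) (hd₂ : F.dist r u₂ ≤ F.dist r v) : u₁ = u₂ := by
  have key : ∀ u, F.Adj v u → F.dist r u ≤ F.dist r v →
      ∃ (p : F.Walk r v), p.IsPath ∧ p.penultimate = u := by
    intro u hu hd
    have hdist : F.dist r v = F.dist r u + 1 := by
      rcases hF.dist_eq_dist_add_one_of_adj_of_reachable r hu hr with h | h
      · exact h
      · omega
    obtain ⟨p, hp⟩ := (hr.trans hu.reachable).exists_walk_length_eq_dist
    refine ⟨p.concat hu.symm, SimpleGraph.Walk.isPath_of_length_eq_dist _ ?_, by simp⟩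
    rw [SimpleGraph.Walk.length_concat, hp, hdist]
  obtain ⟨p₁, hp₁, rfl⟩ := key u₁ h₁ hd₁
  obtain ⟨p₂, hp₂, rfl⟩ := key u₂ h₂ hd₂
  have := (hF.subsingleton_path r v).elim ⟨p₁, hp₁⟩ ⟨p₂, hp₂⟩
  rw [Subtype.mk.injEq] at this
  rw [this]

theorem SimpleGraph.Reachable.exists_closer_neighbor {r v : W} (hr : F.Reachable r v)
    (hne : r ≠ v) : ∃ u, F.Adj v u ∧ F.dist r u < F.dist r v := by
  obtain ⟨p, hp⟩ := hr.exists_walk_length_eq_dist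
  have hnil : ¬ p.Nil := fun h => hne h.eq
  have hadj := p.adj_penultimate hnil
  refine ⟨p.penultimate, hadj.symm, ?_⟩
  have h1 := congrArg SimpleGraph.Walk.length (SimpleGraph.Walk.concat_dropLast hadj)
  rw [SimpleGraph.Walk.length_concat] at h1
  have := SimpleGraph.dist_le p.dropLast
  omega

open Classical in
/-- The vertices of a forest can be ordered by a depth such that each vertex has at most one
neighbour that is not deeper, with the total weight of this elimination being `forestWeight`. -/
theorem SimpleGraph.IsAcyclic.exists_depth {V : Type*} [Fintype W] (hF : F.IsAcyclic)
    (φ : V → W) :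
    ∃ depth : W → ℕ, (∀ v, {u | F.Adj v u ∧ depth u ≤ depth v}.Subsingleton) ∧
      ∑ v, (fiberCard φ v + ∑ u with F.Adj v u ∧ depth u ≤ depth v, fiberCard φ u) ^ 2 ≤
        forestWeight F φ := by
  -- Each tree is rooted at a vertex of smallest fibre, and `depth` is the distance to that root.
  -- Roots then account for the minima in `forestWeight`, the other vertices for the edges to their
  -- parents.
  have hroot : ∀ T : F.ConnectedComponent, ∃ r : W, F.connectedComponentMk r = T ∧
      fiberCard φ r ^ 2 = ⨅ u : T.supp, fiberCard φ (u : W) ^ 2 := fun T => by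
    have : Nonempty T.supp := T.nonempty_supp.to_subtype
    obtain ⟨u, hu⟩ := exists_eq_ciInf_of_finite (f := fun u : T.supp => fiberCard φ (u : W) ^ 2)
    exact ⟨u, u.2, hu⟩
  choose root hroot_mk hroot_min using hroot
  set depth : W → ℕ := fun v => F.dist (root (F.connectedComponentMk v)) v with hdepth
  have hreach : ∀ v, F.Reachable (root (F.connectedComponentMk v)) v := fun v =>
    SimpleGraph.ConnectedComponent.exact (hroot_mk _)
  have hadj_root : ∀ {v u}, F.Adj v u →
      root (F.connectedComponentMk u) = root (F.connectedComponentMk v) := fun h => by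
    rw [SimpleGraph.ConnectedComponent.sound h.reachable]
  have hsub : ∀ v, {u | F.Adj v u ∧ depth u ≤ depth v}.Subsingleton := by
    rintro v u₁ ⟨h₁, hd₁⟩ u₂ ⟨h₂, hd₂⟩
    simp only [hdepth, hadj_root h₁, hadj_root h₂] at hd₁ hd₂
    exact hF.closer_neighbor_unique (hreach v) h₁ h₂ hd₁ hd₂
  have hne : ∀ {v u}, F.Adj v u → depth v ≠ depth u := fun {v u} h => by
    simp only [hdepth, hadj_root h]
    exact hF.dist_ne_of_adj h (hreach v)
  refine ⟨depth, hsub, ?_⟩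
  set a := fiberCard φ with ha
  set nonroot : Finset W := Finset.univ.filter fun v => ∃ u, F.Adj v u ∧ depth u ≤ depth v
  have hpar : ∀ v, ∃ u, (∃ u, F.Adj v u ∧ depth u ≤ depth v) → F.Adj v u ∧ depth u ≤ depth v :=
    fun v => by
      by_cases h : ∃ u, F.Adj v u ∧ depth u ≤ depth v
      · obtain ⟨u, hu⟩ := h
        exact ⟨u, fun _ => hu⟩
      · exact ⟨v, fun h' => absurd h' h⟩
  choose par hpar using hpar
  rw [forestWeight, ← Finset.sum_filter_add_sum_filter_not Finset.univ
    (fun v => ∃ u, F.Adj v u ∧ depth u ≤ depth v)]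
  refine add_le_add ?_ ?_
  -- Two distinct vertices with the same parent edge would be parents of each other and hence of
  -- equal depth, which adjacency excludes.
  · have hinj : Set.InjOn (fun v => s(v, par v)) (nonroot : Set W) := by
      intro v hv w hw hvw
      have hv' := hpar v (Finset.mem_filter.1 hv).2
      have hw' := hpar w (Finset.mem_filter.1 hw).2
      rcases Sym2.eq_iff.1 hvw with h | ⟨h1, h2⟩
      · exact h.1
      · rw [h2] at hv'
        rw [← h1] at hw'
        exact absurd (le_antisymm hw'.2 hv'.2) (hne hv'.1)
    calc _ = ∑ v ∈ nonroot, Sym2.lift ⟨fun u v => (a u + a v) ^ 2, fun u v => by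
          simp only [add_comm]⟩ s(v, par v) := by
          refine Finset.sum_congr rfl fun v hv => ?_
          have hv' := hpar v (Finset.mem_filter.1 hv).2
          have : (Finset.univ.filter fun u => F.Adj v u ∧ depth u ≤ depth v) = {par v} := by
            ext u
            simp only [Finset.mem_filter, Finset.mem_univ, true_and, Finset.mem_singleton]
            exact ⟨fun h => hsub v h hv', fun h => h ▸ hv'⟩
          rw [this, Finset.sum_singleton, Sym2.lift_mk]
      _ = ∑ e ∈ nonroot.image (fun v => s(v, par v)), Sym2.lift ⟨fun u v => (a u + a v) ^ 2,
          fun u v => by simp only [add_comm]⟩ e := (Finset.sum_image hinj).symm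
      _ ≤ _ := Finset.sum_le_sum_of_subset (fun e he => by
          obtain ⟨v, hv, rfl⟩ := Finset.mem_image.1 he
          have hv' := hpar v (Finset.mem_filter.1 hv).2
          simpa using hv'.1)
  · have hroots : ∀ v, (¬ ∃ u, F.Adj v u ∧ depth u ≤ depth v) →
        root (F.connectedComponentMk v) = v := fun v hv => by
      by_contra hrv
      obtain ⟨u, hu, hd⟩ := (hreach v).exists_closer_neighbor hrv
      refine hv ⟨u, hu, ?_⟩
      simp only [hdepth, hadj_root hu]
      exact hd.le
    calc _ = ∑ v ∈ Finset.univ.filter (fun v => ¬ ∃ u, F.Adj v u ∧ depth u ≤ depth v),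
          ⨅ u : (F.connectedComponentMk v).supp, a (u : W) ^ 2 := by
          refine Finset.sum_congr rfl fun v hv => ?_
          simp only [Finset.mem_filter, Finset.mem_univ, true_and] at hv
          have : (Finset.univ.filter fun u => F.Adj v u ∧ depth u ≤ depth v) = ∅ := by
            rw [Finset.filter_eq_empty_iff]
            exact fun u _ hu => hv ⟨u, hu⟩
          rw [this, Finset.sum_empty, add_zero, ← hroot_min, hroots v hv]
      _ = ∑ T ∈ (Finset.univ.filter (fun v => ¬ ∃ u, F.Adj v u ∧ depth u ≤ depth v)).image
          F.connectedComponentMk, ⨅ u : T.supp, a (u : W) ^ 2 := by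
          refine (Finset.sum_image (f := fun T : F.ConnectedComponent =>
            ⨅ u : T.supp, a (u : W) ^ 2) fun v hv w hw hvw => ?_).symm
          rw [← hroots v (by simpa using hv), ← hroots w (by simpa using hw)]
          exact congrArg root hvw
      _ ≤ _ := Finset.sum_le_sum_of_subset (Finset.subset_univ _)

end elimination

/-! ### McDiarmid's inequality for a dependency graph. -/

section dependencyGraph

variable {V α Ω : Type*} [Fintype V] [DecidableEq V] [Fintype α] [MeasurableSpace α]
  [MeasurableSingletonClass α] [MeasurableSpace Ω] {μ : Measure Ω} [IsProbabilityMeasure μ]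

theorem integral_comp_eq_weightedSum {X : Type*} [Fintype X] [MeasurableSpace X]
    [MeasurableSingletonClass X] {Z : Ω → X} (hZ : Measurable Z) (f : X → ℝ) :
    ∫ ω, f (Z ω) ∂μ = weightedSum (fun y => (μ.map Z).real {y}) f := by
  have : IsProbabilityMeasure (μ.map Z) := Measure.isProbabilityMeasure_map hZ.aemeasurable
  rw [← integral_map hZ.aemeasurable (measurable_of_finite f).aestronglyMeasurable,
    integral_fintype (Integrable.of_finite)]
  rfl

theorem integrable_comp_of_finite {X : Type*} [Finite X] [MeasurableSpace X]
    [MeasurableSingletonClass X] {Z : Ω → X} (hZ : Measurable Z) (f : X → ℝ) :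
    Integrable (fun ω => f (Z ω)) μ := by
  have : IsProbabilityMeasure (μ.map Z) := Measure.isProbabilityMeasure_map hZ.aemeasurable
  exact (Integrable.of_finite (μ := μ.map Z) (f := f)).comp_measurable hZ

/-- The variables `X k` merged along the fibres of `φ`; coordinates outside the fibre are padded. -/
def mergedFamily {W : Type*} [DecidableEq W] (φ : V → W) (a : α) (x : V → α) (w : W) (k : V) : α :=
  if φ k = w then x k else a

/-- A function of the merged coordinates in `A` only sees the variables `X k` with `φ k ∈ A`. An
edge of `G` is either collapsed by `φ` or sent to an edge of `F`, so non-adjacent disjoint sets in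
`F` pull back to such sets in `G`, where independence holds. -/
theorem IsDependencyGraph.factorizesOn {W : Type*} [Fintype W] [DecidableEq W]
    {G : SimpleGraph V} {X : V → Ω → α} (hG : IsDependencyGraph G X μ)
    (hX : ∀ k, Measurable (X k)) {F : SimpleGraph W} {φ : V → W} (hφ : IsForestApprox G F φ)
    (a : α) (S : Finset W) :
    FactorizesOn F S fun y =>
      (μ.map fun ω => mergedFamily φ a fun k => X k ω).real {y} := by
  have hXm : Measurable fun ω k => X k ω := measurable_pi_iff.2 hX
  have hZ : Measurable fun ω => mergedFamily φ a fun k => X k ω :=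
    (measurable_of_finite (mergedFamily φ a)).comp hXm
  intro A B _ _ hAB hadj g h hg hh
  have hrepr : ∀ (A : Finset W) (g : (W → V → α) → ℝ), DependsOn g (A : Set W) →
      ∃ g' : ((Finset.univ.filter fun k => φ k ∈ A : Finset V) → α) → ℝ,
        ∀ x : V → α, g (mergedFamily φ a x) = g' fun k => x k := fun A g hg => by
    refine ⟨fun x => g (mergedFamily φ a fun k =>
      if hk : k ∈ (Finset.univ.filter fun k => φ k ∈ A : Finset V) then x ⟨k, hk⟩ else a),
      fun x => hg fun w hw => ?_⟩
    ext k
    by_cases hk : φ k = w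
    · have : φ k ∈ A := hk ▸ hw
      simp [mergedFamily, this]
    · simp [mergedFamily, hk]
  obtain ⟨g', hg'⟩ := hrepr A g hg
  obtain ⟨h', hh'⟩ := hrepr B h hh
  have hind := (hG (Finset.univ.filter fun k => φ k ∈ A) (Finset.univ.filter fun k => φ k ∈ B)
    (Finset.disjoint_left.2 fun k hkA hkB => Finset.disjoint_left.1 hAB
      (Finset.mem_filter.1 hkA).2 (Finset.mem_filter.1 hkB).2)
    (fun u hu v hv huv => by
      have hu := (Finset.mem_filter.1 hu).2
      have hv := (Finset.mem_filter.1 hv).2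
      rcases hφ.map_adj u v huv with h | h
      · exact Finset.disjoint_left.1 hAB hu (h ▸ hv)
      · exact hadj _ hu _ hv h)).comp (measurable_of_finite g') (measurable_of_finite h')
  rw [← integral_comp_eq_weightedSum hZ, ← integral_comp_eq_weightedSum hZ,
    ← integral_comp_eq_weightedSum hZ]
  simp only [hg', hh']
  refine hind.integral_fun_mul_eq_mul_integral ?_ ?_
  · exact ((measurable_of_finite g').comp (measurable_pi_iff.2 fun k => hX k)).aestronglyMeasurable
  · exact ((measurable_of_finite h').comp (measurable_pi_iff.2 fun k => hX k)).aestronglyMeasurable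

omit [Fintype V] [DecidableEq V] in
-- The infimum is attained because the set is nonempty: the one-vertex forest merges everything.
-- Without this, `sInf` could be the default `0`.
theorem exists_forestWeight_eq_forestComplexity (G : SimpleGraph V) :
    ∃ (N : ℕ) (F : SimpleGraph (Fin N)) (φ : V → Fin N),
      IsForestApprox G F φ ∧ forestComplexity G = forestWeight F φ :=
  Nat.sInf_mem (s := {l : ℕ | ∃ (N : ℕ) (F : SimpleGraph (Fin N)) (φ : V → Fin N),
    IsForestApprox G F φ ∧ l = forestWeight F φ})
    ⟨_, 1, ⊥, fun _ => 0, ⟨SimpleGraph.isAcyclic_bot, fun _ _ _ => Or.inl rfl⟩, rfl⟩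

omit [DecidableEq V] in
-- Allows division by the complexity in the Chernoff bound. The elimination sum already contains the
-- square of a nonempty fibre.
theorem one_le_forestComplexity [Nonempty V] (G : SimpleGraph V) : 1 ≤ forestComplexity G := by
  classical
  obtain ⟨N, F, φ, hφ, h⟩ := exists_forestWeight_eq_forestComplexity G
  obtain ⟨depth, -, hle⟩ := hφ.isAcyclic.exists_depth φ
  obtain ⟨k⟩ := ‹Nonempty V›
  rw [h]
  refine le_trans ?_ hle
  refine le_trans ?_ (Finset.single_le_sum (fun v _ => Nat.zero_le _) (Finset.mem_univ (φ k)))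
  have : 1 ≤ fiberCard φ (φ k) := (Set.ncard_pos (Set.toFinite _)).2 ⟨k, rfl⟩
  exact Nat.one_le_pow _ _ (by omega)

/-- Changing a merged coordinate changes at most a whole fibre, so its bound is `c` times the fibre
size, and the elimination cost is at most `c ^ 2` times the weight of an optimal forest
approximation. -/
theorem IsDependencyGraph.integral_exp_le [Nonempty V] {G : SimpleGraph V} {X : V → Ω → α}
    (hG : IsDependencyGraph G X μ) (hX : ∀ k, Measurable (X k)) {f : (V → α) → ℝ} {c : ℝ}
    (hc : 0 ≤ c) (hf : BoundedDifferences f fun _ => c) (s : ℝ) :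
    ∫ ω, Real.exp (s * f fun k => X k ω) ∂μ ≤
      Real.exp (s * ∫ ω, f (fun k => X k ω) ∂μ + s ^ 2 * c ^ 2 * forestComplexity G / 8) := by
  classical
  obtain ⟨N, F, φ, hφ, hΛ⟩ := exists_forestWeight_eq_forestComplexity G
  obtain ⟨depth, hdepth, hle⟩ := hφ.isAcyclic.exists_depth φ
  obtain ⟨k₀⟩ := ‹Nonempty V›
  obtain ⟨ω₀⟩ : Nonempty Ω := nonempty_of_isProbabilityMeasure μ
  set a := X k₀ ω₀
  have hXm : Measurable fun ω k => X k ω := measurable_pi_iff.2 hX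
  have hZ : Measurable fun ω => mergedFamily φ a fun k => X k ω :=
    (measurable_of_finite (mergedFamily φ a)).comp hXm
  set f' : (Fin N → V → α) → ℝ := fun y => f fun k => y (φ k) k with hf'
  have hff' : ∀ x, f x = f' (mergedFamily φ a x) := fun x => by simp [hf', mergedFamily]
  have hbd : BoundedDifferences f' fun w => c * fiberCard φ w := fun y w b => by
    have hcard : (fiberCard φ w : ℝ) = (Finset.univ.filter fun k => φ k = w).card := by
      rw [fiberCard, Set.ncard_eq_toFinset_card']
      congr 2
      ext k
      simp
    have := hf.piecewise_le (Finset.univ.filter fun k => φ k = w) (fun k => y (φ k) k) b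
    rw [Finset.sum_const, nsmul_eq_mul, mul_comm, ← hcard] at this
    refine le_trans (le_of_eq (congrArg f (funext fun k => ?_))) this
    by_cases hk : φ k = w
    · simp [hk]
    · simp [hk]
  have : IsProbabilityMeasure (μ.map fun ω => mergedFamily φ a fun k => X k ω) :=
    Measure.isProbabilityMeasure_map hZ.aemeasurable
  have key := weightedSum_exp_le F depth hdepth (fun w => c * fiberCard φ w)
    (fun w => by positivity) s Finset.univ
    (fun y => (μ.map fun ω => mergedFamily φ a fun k => X k ω).real {y})
    (fun y => measureReal_nonneg) (by simp)
    (hG.factorizesOn hX hφ a _) f' (fun y y' h => congrArg f' (funext fun w => h w (by simp))) hbd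
  rw [← integral_comp_eq_weightedSum hZ, ← integral_comp_eq_weightedSum hZ] at key
  simp only [← hff'] at key
  refine key.trans (Real.exp_le_exp.2 ?_)
  have hsum : ∑ v, (c * (fiberCard φ v : ℝ) +
      ∑ u with F.Adj v u ∧ depth u ≤ depth v, c * (fiberCard φ u : ℝ)) ^ 2 ≤
        c ^ 2 * forestComplexity G := by
    rw [hΛ]
    have hle' : (_ : ℝ) ≤ _ := Nat.cast_le.2 hle
    push_cast at hle'
    refine le_trans (le_of_eq ?_) (mul_le_mul_of_nonneg_left hle' (sq_nonneg c))
    rw [Finset.mul_sum]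
    refine Finset.sum_congr rfl fun v _ => ?_
    rw [← Finset.mul_sum]
    ring
  have := mul_le_mul_of_nonneg_left hsum (by positivity : 0 ≤ s ^ 2 / 8)
  calc _ ≤ _ := add_le_add le_rfl this
    _ = _ := by ring

/-- McDiarmid's inequality for graph-dependent variables. -/
theorem IsDependencyGraph.mcdiarmid [Nonempty V] {G : SimpleGraph V} {X : V → Ω → α}
    (hG : IsDependencyGraph G X μ) (hX : ∀ k, Measurable (X k)) {f : (V → α) → ℝ} {c : ℝ}
    (hc : 0 < c) (hf : BoundedDifferences f fun _ => c) {δ : ℝ} (hδ0 : 0 < δ) (hδ1 : δ ≤ 1) :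
    μ.real {ω | ∫ ω, f (fun k => X k ω) ∂μ +
      c * Real.sqrt (forestComplexity G * Real.log (1 / δ) / 2) ≤ f fun k => X k ω} ≤ δ := by
  have hXm : Measurable fun ω k => X k ω := measurable_pi_iff.2 hX
  set L : ℝ := (forestComplexity G : ℝ) with hL
  have hL0 : 0 < L := Nat.cast_pos.2 (one_le_forestComplexity G)
  set l := Real.log (1 / δ) with hl
  have hl0 : 0 ≤ l := Real.log_nonneg (by rw [le_div_iff₀ hδ0]; linarith)
  set t := c * Real.sqrt (L * l / 2) with ht
  have ht2 : t ^ 2 = c ^ 2 * (L * l / 2) := by rw [ht, mul_pow, Real.sq_sqrt (by positivity)]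
  -- The minimiser of the Chernoff exponent `-s t + s² c² L / 8`; its minimum is `-l`.
  set s := 4 * t / (c ^ 2 * L) with hs
  have hs0 : 0 ≤ s := by positivity
  refine (measure_ge_le_exp_mul_mgf _ hs0
    (integrable_comp_of_finite hXm fun x => Real.exp (s * f x))).trans ?_
  refine (mul_le_mul_of_nonneg_left (hG.integral_exp_le hX hc.le hf s)
    (Real.exp_pos _).le).trans ?_
  rw [← Real.exp_add]
  have : δ = Real.exp (-l) := by
    rw [hl, one_div, Real.log_inv, neg_neg, Real.exp_log hδ0]
  rw [this, Real.exp_le_exp]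
  have h1 : s * t = 2 * l := by
    rw [hs, div_mul_eq_mul_div, mul_assoc, ← sq, ht2]
    field_simp
    ring
  have h2 : s ^ 2 * c ^ 2 * L / 8 = l := by
    rw [hs, div_pow, mul_pow, ht2]
    field_simp
    ring
  rw [h2]
  nlinarith

end dependencyGraph

/-! ### Concentration of sample means of bounded vectors. -/

section sampleMean

variable {n K : ℕ} {Ω : Type*} [MeasurableSpace Ω] {μ : Measure Ω} [IsProbabilityMeasure μ]
  {J : Fin K → Ω → Fin n} {ξ : Fin n → ℝ} {G : SimpleGraph (Fin K)}
  {E : Type*} [NormedAddCommGroup E] [InnerProductSpace ℝ E]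

omit [IsProbabilityMeasure μ] in
theorem map_real_singleton (hJ : ∀ k, Measurable (J k)) (hξ : ∀ k t, μ.real {ω | J k ω = t} = ξ t)
    (k : Fin K) (t : Fin n) : (μ.map (J k)).real {t} = ξ t := by
  rw [map_measureReal_apply (hJ k) (measurableSet_singleton t), ← hξ k t]
  rfl

theorem integral_sample (hJ : ∀ k, Measurable (J k)) (hξ : ∀ k t, μ.real {ω | J k ω = t} = ξ t)
    (k : Fin K) (f : Fin n → ℝ) : ∫ ω, f (J k ω) ∂μ = ∑ t, ξ t * f t := by
  rw [integral_comp_eq_weightedSum (hJ k)]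
  simp only [weightedSum, map_real_singleton hJ hξ]

theorem sum_distribution (hJ : ∀ k, Measurable (J k))
    (hξ : ∀ k t, μ.real {ω | J k ω = t} = ξ t) (k : Fin K) : ∑ t, ξ t = 1 := by
  simpa using (integral_sample hJ hξ k fun _ => 1).symm

theorem IsDependencyGraph.integral_of_not_adj (hG : IsDependencyGraph G J μ)
    (hJ : ∀ k, Measurable (J k)) (hξ : ∀ k t, μ.real {ω | J k ω = t} = ξ t) {k l : Fin K}
    (hkl : k ≠ l) (hadj : ¬ G.Adj k l) (u : Fin n → Fin n → ℝ) :
    ∫ ω, u (J k ω) (J l ω) ∂μ = ∑ s, ξ s * ∑ t, ξ t * u s t := by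
  have hind : IndepFun (J k) (J l) μ :=
    (hG {k} {l} (by simpa using hkl) (by simpa using hadj)).comp
      (measurable_pi_apply (⟨k, by simp⟩ : ({k} : Finset (Fin K))))
      (measurable_pi_apply (⟨l, by simp⟩ : ({l} : Finset (Fin K))))
  have hkl : Measurable fun ω => (J k ω, J l ω) := (hJ k).prodMk (hJ l)
  rw [integral_comp_eq_weightedSum hkl fun p : Fin n × Fin n => u p.1 p.2, weightedSum,
    Fintype.sum_prod_type]
  refine Finset.sum_congr rfl fun s _ => ?_
  rw [Finset.mul_sum]
  refine Finset.sum_congr rfl fun t _ => ?_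
  have : (μ.map fun ω => (J k ω, J l ω)).real {(s, t)} = ξ s * ξ t := by
    rw [← map_real_singleton hJ hξ k s, ← map_real_singleton hJ hξ l t,
      map_measureReal_apply hkl (measurableSet_singleton _),
      map_measureReal_apply (hJ k) (measurableSet_singleton _),
      map_measureReal_apply (hJ l) (measurableSet_singleton _), measureReal_def, measureReal_def,
      measureReal_def, ← ENNReal.toReal_mul,
      ← hind.measure_inter_preimage_eq_mul _ _ (measurableSet_singleton s)
        (measurableSet_singleton t)]
    congr 2
    ext ω
    simp
  rw [this, mul_assoc]

/-- The second moment of a centred sum of graph-dependent bounded vectors. -/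
theorem IsDependencyGraph.integral_norm_sum_sq_le (hG : IsDependencyGraph G J μ)
    (hJ : ∀ k, Measurable (J k)) (hξ : ∀ k t, μ.real {ω | J k ω = t} = ξ t) (hK : 0 < K)
    (z : Fin n → E) {R : ℝ} (hR : ∀ t, ‖z t‖ ≤ R) :
    ∫ ω, ‖∑ k, (z (J k ω) - ∑ t, ξ t • z t)‖ ^ 2 ∂μ ≤ R ^ 2 * (K + 2 * G.edgeSet.ncard) := by
  classical
  have hξ1 := sum_distribution hJ hξ ⟨0, hK⟩
  have hξ0 : ∀ t, 0 ≤ ξ t := fun t => hξ ⟨0, hK⟩ t ▸ measureReal_nonneg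
  set zbar := ∑ t, ξ t • z t with hzbar
  set u : Fin n → Fin n → ℝ := fun s t => inner ℝ (z s - zbar) (z t - zbar) with hu
  have hcenter : ∑ t, ξ t • (z t - zbar) = 0 := by
    simp only [smul_sub, Finset.sum_sub_distrib, ← Finset.sum_smul, hξ1, one_smul]
    rw [hzbar, sub_self]
  have hvar : ∑ t, ξ t * ‖z t - zbar‖ ^ 2 ≤ R ^ 2 := by
    have h1 : ∑ t, ξ t * inner ℝ (z t) zbar = ‖zbar‖ ^ 2 := by
      rw [← real_inner_self_eq_norm_sq]
      conv_rhs => rw [hzbar, sum_inner]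
      refine Finset.sum_congr rfl fun t _ => ?_
      rw [real_inner_smul_left]
    have h2 : ∑ t, ξ t * ‖z t‖ ^ 2 ≤ R ^ 2 := by
      calc ∑ t, ξ t * ‖z t‖ ^ 2 ≤ ∑ t, ξ t * R ^ 2 := Finset.sum_le_sum fun t _ =>
            mul_le_mul_of_nonneg_left (pow_le_pow_left₀ (norm_nonneg _) (hR t) 2) (hξ0 t)
        _ = R ^ 2 := by rw [← Finset.sum_mul, hξ1, one_mul]
    have h3 : ∑ t, ξ t * ‖z t - zbar‖ ^ 2 = ∑ t, ξ t * ‖z t‖ ^ 2 - ‖zbar‖ ^ 2 := by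
      simp only [norm_sub_sq_real, mul_add, mul_sub, Finset.sum_add_distrib,
        Finset.sum_sub_distrib, ← Finset.sum_mul, hξ1, one_mul]
      have : ∑ t, ξ t * (2 * inner ℝ (z t) zbar) = 2 * ‖zbar‖ ^ 2 := by
        rw [← h1, Finset.mul_sum]
        exact Finset.sum_congr rfl fun t _ => by ring
      rw [this]
      ring
    nlinarith [sq_nonneg ‖zbar‖]
  have hJm : Measurable fun ω k => J k ω := measurable_pi_iff.2 hJ
  have hint : ∀ f : (Fin K → Fin n) → ℝ, Integrable (fun ω => f fun k => J k ω) μ :=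
    integrable_comp_of_finite hJm
  -- Every covariance is at most the common variance, by Cauchy–Schwarz and AM–GM, and it vanishes
  -- for distinct non-adjacent indices by independence and centring. Counting ordered pairs leaves
  -- `K` diagonal and `2|E(G)|` adjacent ones.
  have hpair : ∀ k l, ∫ ω, u (J k ω) (J l ω) ∂μ ≤
      R ^ 2 * ((if k = l then 1 else 0) + if G.Adj k l then 1 else 0) := fun k l => by
    have hle : ∫ ω, u (J k ω) (J l ω) ∂μ ≤ R ^ 2 := by
      calc ∫ ω, u (J k ω) (J l ω) ∂μ
          ≤ ∫ ω, ((‖z (J k ω) - zbar‖ ^ 2 + ‖z (J l ω) - zbar‖ ^ 2) / 2) ∂μ := by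
            refine integral_mono (hint fun x => u (x k) (x l))
              (hint fun x => (‖z (x k) - zbar‖ ^ 2 + ‖z (x l) - zbar‖ ^ 2) / 2) fun ω => ?_
            have := real_inner_le_norm (z (J k ω) - zbar) (z (J l ω) - zbar)
            have := sq_nonneg (‖z (J k ω) - zbar‖ - ‖z (J l ω) - zbar‖)
            simp only [hu]
            linarith
        _ = ((∑ t, ξ t * ‖z t - zbar‖ ^ 2) + ∑ t, ξ t * ‖z t - zbar‖ ^ 2) / 2 := by
            rw [integral_div, integral_add (hint fun x => ‖z (x k) - zbar‖ ^ 2)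
              (hint fun x => ‖z (x l) - zbar‖ ^ 2), integral_sample hJ hξ k fun t =>
              ‖z t - zbar‖ ^ 2, integral_sample hJ hξ l fun t => ‖z t - zbar‖ ^ 2]
        _ ≤ R ^ 2 := by linarith
    by_cases hkl : k = l
    · simpa [hkl, G.loopless.irrefl] using hkl ▸ hle
    · by_cases hadj : G.Adj k l
      · simpa [hkl, hadj] using hle
      · rw [hG.integral_of_not_adj hJ hξ hkl hadj]
        simp only [hkl, hadj, if_false, add_zero, mul_zero]
        refine (Finset.sum_eq_zero fun s _ => ?_).le
        have : ∑ t, ξ t * u s t = inner ℝ (z s - zbar) (∑ t, ξ t • (z t - zbar)) := by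
          rw [inner_sum]
          exact Finset.sum_congr rfl fun t _ => (real_inner_smul_right _ _ _).symm
        rw [this, hcenter, inner_zero_right, mul_zero]
  calc ∫ ω, ‖∑ k, (z (J k ω) - zbar)‖ ^ 2 ∂μ
      = ∫ ω, ∑ k, ∑ l, u (J k ω) (J l ω) ∂μ := by
        refine integral_congr_ae (ae_of_all _ fun ω => ?_)
        simp only [← real_inner_self_eq_norm_sq, sum_inner, inner_sum, hu]
        exact Finset.sum_comm
    _ = ∑ k, ∑ l, ∫ ω, u (J k ω) (J l ω) ∂μ := by
        rw [integral_finsetSum _ fun k _ => hint fun x => ∑ l, u (x k) (x l)]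
        refine Finset.sum_congr rfl fun k _ => ?_
        rw [integral_finsetSum _ fun l _ => hint fun x => u (x k) (x l)]
    _ ≤ ∑ k, ∑ l, R ^ 2 * ((if k = l then 1 else 0) + if G.Adj k l then 1 else 0) :=
        Finset.sum_le_sum fun k _ => Finset.sum_le_sum fun l _ => hpair k l
    _ = R ^ 2 * (K + 2 * G.edgeSet.ncard) := by
        simp only [← Finset.mul_sum, Finset.sum_add_distrib]
        congr 2
        · simp
        · have h1 := G.sum_degrees_eq_twice_card_edges
          have h2 : G.edgeSet.ncard = G.edgeFinset.card := by
            rw [← SimpleGraph.coe_edgeFinset, Set.ncard_coe_finset]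
          rw [h2]
          have h3 : ((∑ v, G.degree v : ℕ) : ℝ) = ((2 * G.edgeFinset.card : ℕ) : ℝ) := by rw [h1]
          push_cast at h3
          rw [← h3]
          refine Finset.sum_congr rfl fun k _ => ?_
          rw [Finset.sum_boole, ← SimpleGraph.card_neighborFinset_eq_degree,
            SimpleGraph.neighborFinset_eq_filter]

/-- The mean of graph-dependent samples of bounded vectors concentrates around its expectation. -/
theorem IsDependencyGraph.sampleMean_deviation (hG : IsDependencyGraph G J μ)
    (hJ : ∀ k, Measurable (J k)) (hξ : ∀ k t, μ.real {ω | J k ω = t} = ξ t) (hK : 0 < K)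
    (z : Fin n → E) {R : ℝ} (hR : ∀ t, ‖z t‖ ≤ R) (hR0 : 0 ≤ R) {δ : ℝ} (hδ0 : 0 < δ)
    (hδ1 : δ ≤ 1) :
    μ.real {ω | R * (Real.sqrt ((K + 2 * G.edgeSet.ncard) / (K : ℝ) ^ 2) +
      Real.sqrt (2 * forestComplexity G * Real.log (1 / δ) / (K : ℝ) ^ 2)) <
        ‖(K : ℝ)⁻¹ • ∑ k, z (J k ω) - ∑ t, ξ t • z t‖} ≤ δ := by
  have hK' : (0 : ℝ) < K := Nat.cast_pos.2 hK
  have hne : Nonempty (Fin K) := ⟨⟨0, hK⟩⟩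
  set zbar := ∑ t, ξ t • z t with hzbar
  -- `R = 0` is separate because McDiarmid's inequality is used with the positive constant `2 * R /
  -- K`, the largest effect of replacing one sample.
  rcases hR0.eq_or_lt with rfl | hRpos
  · have hz : ∀ t, z t = 0 := fun t => norm_le_zero_iff.1 (hR t)
    simp [hz, hzbar, hδ0.le]
  set f : (Fin K → Fin n) → ℝ := fun x => ‖(K : ℝ)⁻¹ • ∑ k, z (x k) - zbar‖ with hf
  have hbd : BoundedDifferences f fun _ => 2 * R / K := fun x k b => by
    have hsum : ∑ l, z (Function.update x k b l) = ∑ l, z (x l) + (z b - z (x k)) := by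
      rw [← sub_eq_iff_eq_add', ← Finset.sum_sub_distrib, Finset.sum_eq_single k]
      · simp
      · intro l _ hl
        simp [hl]
      · simp
    have hsplit : (K : ℝ)⁻¹ • ∑ l, z (Function.update x k b l) - zbar =
        ((K : ℝ)⁻¹ • ∑ l, z (x l) - zbar) + (K : ℝ)⁻¹ • (z b - z (x k)) := by
      rw [hsum, smul_add]
      abel
    simp only [hf]
    rw [hsplit]
    refine (norm_add_le _ _).trans (add_le_add le_rfl ?_)
    rw [norm_smul, norm_inv, Real.norm_natCast, inv_mul_eq_div]
    gcongr
    exact (norm_sub_le _ _).trans (by linarith [hR b, hR (x k)])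
  have hJm : Measurable fun ω k => J k ω := measurable_pi_iff.2 hJ
  have hint : ∀ f : (Fin K → Fin n) → ℝ, Integrable (fun ω => f fun k => J k ω) μ :=
    integrable_comp_of_finite hJm
  have hmean : ∫ ω, f (fun k => J k ω) ∂μ ≤
      R * Real.sqrt ((K + 2 * G.edgeSet.ncard) / (K : ℝ) ^ 2) := by
    set e := ∫ ω, f (fun k => J k ω) ∂μ with he
    -- Nonnegativity of the variance of `f`.
    have hsq : e ^ 2 ≤ ∫ ω, f (fun k => J k ω) ^ 2 ∂μ := by
      have h0 : 0 ≤ ∫ ω, (f (fun k => J k ω) - e) ^ 2 ∂μ := integral_nonneg fun ω => sq_nonneg _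
      have h1 : ∫ ω, (f (fun k => J k ω) - e) ^ 2 ∂μ =
          ∫ ω, f (fun k => J k ω) ^ 2 ∂μ - 2 * e * e + e ^ 2 := by
        calc _ = ∫ ω, (f (fun k => J k ω) ^ 2 - 2 * e * f (fun k => J k ω) + e ^ 2) ∂μ := by
              refine integral_congr_ae (ae_of_all _ fun ω => ?_)
              simp only
              ring
          _ = _ := by
              rw [integral_add (hint fun x => f x ^ 2 - 2 * e * f x) (integrable_const _),
                integral_sub (hint fun x => f x ^ 2) (hint fun x => 2 * e * f x),
                integral_const_mul, integral_const, ← he]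
              simp
      nlinarith
    have hsecond : ∫ ω, f (fun k => J k ω) ^ 2 ∂μ ≤
        R ^ 2 * ((K + 2 * G.edgeSet.ncard) / (K : ℝ) ^ 2) := by
      have hform : ∀ x : Fin K → Fin n, f x ^ 2 =
          ((K : ℝ) ^ 2)⁻¹ * ‖∑ k, (z (x k) - zbar)‖ ^ 2 := fun x => by
        have : (K : ℝ)⁻¹ • ∑ k, z (x k) - zbar = (K : ℝ)⁻¹ • ∑ k, (z (x k) - zbar) := by
          rw [Finset.sum_sub_distrib, smul_sub, Finset.sum_const, Finset.card_univ,
            Fintype.card_fin, ← Nat.cast_smul_eq_nsmul ℝ, smul_smul, inv_mul_cancel₀ hK'.ne',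
            one_smul]
        simp only [hf]
        rw [this, norm_smul, mul_pow, norm_inv, Real.norm_natCast, inv_pow]
      simp only [hform]
      rw [integral_const_mul]
      refine (mul_le_mul_of_nonneg_left (hG.integral_norm_sum_sq_le hJ hξ hK z hR)
        (by positivity)).trans (le_of_eq ?_)
      ring
    refine abs_le_of_sq_le_sq' ?_ (by positivity) |>.2
    rw [mul_pow, Real.sq_sqrt (by positivity)]
    exact hsq.trans hsecond
  refine le_trans (measureReal_mono ?_) (hG.mcdiarmid hJ (by positivity : 0 < 2 * R / K) hbd hδ0 hδ1)
  intro ω hω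
  have hω' : _ < f fun k => J k ω := hω
  have hs : R * Real.sqrt (2 * forestComplexity G * Real.log (1 / δ) / (K : ℝ) ^ 2) =
      2 * R / K * Real.sqrt (forestComplexity G * Real.log (1 / δ) / 2) := by
    have : 2 * forestComplexity G * Real.log (1 / δ) / (K : ℝ) ^ 2 =
        (2 / K) ^ 2 * (forestComplexity G * Real.log (1 / δ) / 2) := by
      field_simp
    rw [this, Real.sqrt_mul (by positivity), Real.sqrt_sq (by positivity)]
    ring
  rw [mul_add, hs] at hω'
  exact (add_le_add hmean le_rfl).trans hω'.le

end sampleMean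

/-! ### From the deviation of the sample mean to the optimality gap. -/

section gap

variable {m n K : ℕ}

/-- The vector that a solution of the sampled problem induces on the original columns. -/
def pushSolution (J : Fin K → Fin n) (x : Fin K → ℝ) : Fin n → ℝ :=
  ∑ k, x k • Pi.single (J k) 1

theorem pushSolution_nonneg (J : Fin K → Fin n) {x : Fin K → ℝ} (hx : 0 ≤ x) :
    0 ≤ pushSolution J x :=
  Finset.sum_nonneg fun k _ => smul_nonneg (hx k) (Pi.single_nonneg.2 zero_le_one)

theorem mulVec_pushSolution (A : Matrix (Fin m) (Fin n) ℝ) (J : Fin K → Fin n) (x : Fin K → ℝ) :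
    A *ᵥ pushSolution J x = colSub A J *ᵥ x := by
  simp only [pushSolution, mulVec_sum, mulVec_smul, mulVec_single_one]
  ext i
  simp only [Finset.sum_apply, Pi.smul_apply, smul_eq_mul, colSub, mulVec, dotProduct,
    submatrix_apply, id, col_apply]
  exact Finset.sum_congr rfl fun k _ => mul_comm _ _

theorem dotProduct_pushSolution (c : Fin n → ℝ) (J : Fin K → Fin n) (x : Fin K → ℝ) :
    c ⬝ᵥ pushSolution J x = (c ∘ J) ⬝ᵥ x := by
  simp only [pushSolution, dotProduct_sum, dotProduct_smul, dotProduct_single, mul_one,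
    smul_eq_mul]
  exact Finset.sum_congr rfl fun k _ => mul_comm _ _

/-- The optimal value of the sampled problem is bounded through a basis of the full problem and an
arbitrary nonnegative combination of the sampled columns. -/
theorem exists_basis_optValue_sampled_le {A : Matrix (Fin m) (Fin n) ℝ} {b : Fin m → ℝ}
    {c : Fin n → ℝ} (hbdd : BddBelow ((fun x => c ⬝ᵥ x) '' stdFeasible A b)) {J : Fin K → Fin n}
    (hne : (stdFeasible (colSub A J) b).Nonempty) (hrank : (colSub A J).rank = m) :
    ∃ B, IsLPBasis A B ∧ ∀ x : Fin K → ℝ, 0 ≤ x → ∀ y : Fin n → ℝ, A *ᵥ y = b →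
      optValue (c ∘ J) (stdFeasible (colSub A J) b) ≤
        ((c ⬝ᵥ y + reducedCost A c B ⬝ᵥ (pushSolution J x - y) : ℝ) : EReal) := by
  obtain ⟨L, hL⟩ := hbdd
  obtain ⟨B, hB, hdual, hopt⟩ := exists_optimal_dual_basis (colSub A J) hrank b (c ∘ J) hne ⟨L, by
    rintro _ ⟨x, ⟨hx, hx0⟩, rfl⟩
    refine hL ⟨pushSolution J x, ⟨?_, pushSolution_nonneg J hx0⟩, dotProduct_pushSolution c J x⟩
    rw [mulVec_pushSolution, hx]⟩
  -- A basis of sampled columns is a basis of `A` through `J`, with the same dual solution `p`.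
  -- Since `A y = b`, the right side equals `pᵀb` plus the slack `c_Jᵀx - pᵀA_J x`, nonnegative by
  -- dual feasibility; `A_J x = b` is not required.
  refine ⟨J ∘ B, hB, fun x hx y hy => hopt.trans (EReal.coe_le_coe_iff.2 ?_)⟩
  set p := dualBasicSolution A c (J ∘ B) with hp
  have hp' : dualBasicSolution (colSub A J) (c ∘ J) B = p := rfl
  rw [hp'] at hdual ⊢
  have h1 : p ⬝ᵥ (colSub A J *ᵥ x) ≤ (c ∘ J) ⬝ᵥ x := by
    rw [dotProduct_col_combination]
    exact Finset.sum_le_sum fun k _ => mul_le_mul_of_nonneg_right (hdual k) (hx k)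
  rw [reducedCost, ← hp, sub_dotProduct, ← dotProduct_mulVec, mulVec_sub, hy,
    mulVec_pushSolution, dotProduct_sub, dotProduct_sub, dotProduct_pushSolution]
  linarith

/-- Both gaps subtract the same `v(P)`, so it suffices to compare optimal values; the rearrangement
in `EReal` needs no finiteness. -/
theorem gapSampled_le_gapDistr_add {A : Matrix (Fin m) (Fin n) ℝ} {b : Fin m → ℝ}
    {c : Fin n → ℝ} {J : Fin K → Fin n} {C : ℝ} {ξ y : Fin n → ℝ}
    (hy : ∀ x ∈ distrFeasible A b C ξ, c ⬝ᵥ y ≤ c ⬝ᵥ x) {r r' : ℝ} (hr : r ≤ r')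
    (h : optValue (c ∘ J) (stdFeasible (colSub A J) b) ≤ ((c ⬝ᵥ y + r : ℝ) : EReal)) :
    gapSampled A b c J ≤ gapDistr A b c C ξ + (r' : EReal) := by
  have h1 : ((c ⬝ᵥ y : ℝ) : EReal) ≤ optValue c (distrFeasible A b C ξ) :=
    le_iInf₂ fun x hx => EReal.coe_le_coe_iff.2 (hy x hx)
  rw [gapSampled, gapDistr, sub_eq_add_neg, sub_eq_add_neg, add_right_comm]
  refine add_le_add (h.trans ?_) le_rfl
  rw [EReal.coe_add]
  exact add_le_add h1 (EReal.coe_le_coe_iff.2 hr)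

theorem gapDistr_eq_top {A : Matrix (Fin m) (Fin n) ℝ} {b : Fin m → ℝ} {c : Fin n → ℝ}
    (hfeas : (stdFeasible A b).Nonempty) {C : ℝ} {ξ : Fin n → ℝ}
    (h : ¬ (distrFeasible A b C ξ).Nonempty) : gapDistr A b c C ξ = ⊤ := by
  obtain ⟨x, hx⟩ := hfeas
  have h1 : optValue c (stdFeasible A b) ≠ ⊤ :=
    ((iInf₂_le x hx).trans_lt (EReal.coe_lt_top _)).ne
  rw [gapDistr, Set.not_nonempty_iff_eq_empty.1 h, sub_eq_add_neg]
  simp only [optValue, Set.mem_empty_iff_false, iInf_false, iInf_top]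
  exact EReal.top_add_of_ne_bot (by rwa [ne_eq, EReal.neg_eq_bot_iff])

theorem exists_distr_optimal {A : Matrix (Fin m) (Fin n) ℝ} {b : Fin m → ℝ} (c : Fin n → ℝ)
    {C : ℝ} {ξ : Fin n → ℝ} (h : (distrFeasible A b C ξ).Nonempty) :
    ∃ y ∈ distrFeasible A b C ξ, ∀ x ∈ distrFeasible A b C ξ, c ⬝ᵥ y ≤ c ⬝ᵥ x := by
  have heq : distrFeasible A b C ξ = Set.Icc 0 (C • ξ) ∩ (fun x => A *ᵥ x) ⁻¹' {b} := by
    ext x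
    simp only [distrFeasible, Set.mem_ofPred_eq, Set.mem_inter_iff, Set.mem_Icc, Set.mem_preimage,
      Set.mem_singleton_iff]
    tauto
  have hcomp : IsCompact (distrFeasible A b C ξ) := by
    rw [heq]
    exact isCompact_Icc.inter_right (isClosed_singleton.preimage (by fun_prop))
  obtain ⟨y, hy, hmin⟩ := hcomp.exists_isMinOn h
    (by unfold dotProduct; fun_prop : Continuous fun x => c ⬝ᵥ x).continuousOn
  exact ⟨y, hy, fun x hx => hmin hx⟩

theorem l2Norm_eq (v : Fin n → ℝ) : l2Norm v = ‖WithLp.toLp 2 v‖ := by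
  simp [l2Norm, EuclideanSpace.norm_eq]

theorem dotProduct_le_l2Norm (v w : Fin n → ℝ) : v ⬝ᵥ w ≤ l2Norm v * ‖WithLp.toLp 2 w‖ := by
  rw [l2Norm_eq]
  refine le_trans (le_of_eq ?_) (real_inner_le_norm (WithLp.toLp 2 v) (WithLp.toLp 2 w))
  rw [PiLp.inner_apply]
  exact Finset.sum_congr rfl fun i _ => by simp [mul_comm]

/-- The `√m` here and the one in `l2Norm_col_le` multiply to the factor `m` in bound (i). -/
theorem dotProduct_le_linftyNorm (p w : Fin m → ℝ) :
    p ⬝ᵥ w ≤ linftyNorm p * Real.sqrt m * ‖WithLp.toLp 2 w‖ := by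
  have h0 : 0 ≤ linftyNorm p := Real.iSup_nonneg fun i => abs_nonneg _
  have hp : l2Norm p ≤ linftyNorm p * Real.sqrt m := by
    rw [l2Norm]
    refine Real.sqrt_le_iff.2 ⟨by positivity, ?_⟩
    rw [mul_pow, Real.sq_sqrt (Nat.cast_nonneg m)]
    refine (Finset.sum_le_sum fun i _ => sq_le_sq' (b := linftyNorm p) ?_ ?_).trans (le_of_eq ?_)
    · have := le_ciSup (Set.finite_range fun i => |p i|).bddAbove i
      exact (abs_le.1 this).1
    · have := le_ciSup (Set.finite_range fun i => |p i|).bddAbove i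
      exact (abs_le.1 this).2
    · simp [mul_comm]
  exact (dotProduct_le_l2Norm p w).trans (mul_le_mul_of_nonneg_right hp (norm_nonneg _))

theorem l2Norm_col_le (A : Matrix (Fin m) (Fin n) ℝ) (t : Fin n) :
    ‖WithLp.toLp 2 (A.col t)‖ ≤ Real.sqrt m * maxNorm A := by
  have h0 : 0 ≤ maxNorm A := Real.iSup_nonneg fun i => abs_nonneg _
  rw [← l2Norm_eq, l2Norm]
  refine Real.sqrt_le_iff.2 ⟨by positivity, ?_⟩
  rw [mul_pow, Real.sq_sqrt (Nat.cast_nonneg m)]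
  have : ∀ i, |A i t| ≤ maxNorm A := fun i =>
    le_ciSup (f := fun ij : Fin m × Fin n => |A ij.1 ij.2|) (Set.finite_range _).bddAbove (i, t)
  refine (Finset.sum_le_sum fun i _ => sq_le_sq' (b := maxNorm A) (abs_le.1 (this i)).1
    (abs_le.1 (this i)).2).trans (le_of_eq ?_)
  simp

/-- The importance-weighted unit vector of the column `t`. -/
noncomputable def weightedSingle (ξ y : Fin n → ℝ) (t : Fin n) : EuclideanSpace ℝ (Fin n) :=
  WithLp.toLp 2 ((y t / ξ t) • Pi.single t 1)

theorem abs_div_distribution_le {C : ℝ} (hC : 0 ≤ C) {ξ y : Fin n → ℝ} (hξ : ∀ t, 0 ≤ ξ t)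
    (hy0 : 0 ≤ y) (hy : y ≤ C • ξ) (t : Fin n) : |y t / ξ t| ≤ C := by
  rw [abs_of_nonneg (div_nonneg (hy0 t) (hξ t))]
  exact div_le_of_le_mul₀ (hξ t) hC (hy t)

theorem sum_smul_weightedSingle {C : ℝ} {ξ y : Fin n → ℝ} (hy0 : 0 ≤ y) (hy : y ≤ C • ξ) :
    ∑ t, ξ t • weightedSingle ξ y t = WithLp.toLp 2 y := by
  have : ∀ t, ξ t * (y t / ξ t) = y t := fun t => by
    -- A column of probability zero has `y t = 0`, since `0 ≤ y ≤ C ξ`, so importance weighting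
    -- loses nothing.
    by_cases h : ξ t = 0
    · have h1 := hy t
      have h2 := hy0 t
      simp only [Pi.smul_apply, h, smul_zero, Pi.zero_apply] at h1 h2
      rw [h, zero_mul]
      linarith
    · exact mul_div_cancel₀ _ h
  simp only [weightedSingle, ← WithLp.toLp_smul, ← WithLp.toLp_sum, smul_smul, this]
  congr 1
  ext i
  simp [Pi.single_apply]

theorem smul_sum_weightedSingle (ξ y : Fin n → ℝ) (J : Fin K → Fin n) :
    (K : ℝ)⁻¹ • ∑ k, weightedSingle ξ y (J k) =
      WithLp.toLp 2 (pushSolution J fun k => (K : ℝ)⁻¹ * (y (J k) / ξ (J k))) := by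
  simp only [weightedSingle, ← WithLp.toLp_smul, ← WithLp.toLp_sum, pushSolution, mul_smul,
    Finset.smul_sum]

theorem norm_weightedSingle_le {C : ℝ} (hC : 0 ≤ C) {ξ y : Fin n → ℝ} (hξ : ∀ t, 0 ≤ ξ t)
    (hy0 : 0 ≤ y) (hy : y ≤ C • ξ) (t : Fin n) : ‖weightedSingle ξ y t‖ ≤ C := by
  rw [weightedSingle, WithLp.toLp_smul, norm_smul, Real.norm_eq_abs]
  simpa using abs_div_distribution_le hC hξ hy0 hy t

theorem norm_toEuclideanLin_weightedSingle_le (A : Matrix (Fin m) (Fin n) ℝ) {C : ℝ} (hC : 0 ≤ C)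
    {ξ y : Fin n → ℝ} (hξ : ∀ t, 0 ≤ ξ t) (hy0 : 0 ≤ y) (hy : y ≤ C • ξ) (t : Fin n) :
    ‖Matrix.toEuclideanLin A (weightedSingle ξ y t)‖ ≤ C * (Real.sqrt m * maxNorm A) := by
  have : Matrix.toEuclideanLin A (weightedSingle ξ y t) =
      (y t / ξ t) • WithLp.toLp 2 (A.col t) := by
    rw [weightedSingle, Matrix.toLpLin_toLp, Matrix.toLin'_apply, mulVec_smul, mulVec_single_one]
    rfl
  rw [this, norm_smul, Real.norm_eq_abs]
  exact mul_le_mul (abs_div_distribution_le hC hξ hy0 hy t) (l2Norm_col_le A t) (norm_nonneg _) hC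

theorem one_sub_le_measureReal {Ω : Type*} [MeasurableSpace Ω] {μ : Measure Ω}
    [IsProbabilityMeasure μ] {S T : Set Ω} {δ : ℝ} (hS : μ.real S ≤ δ) (h : ∀ ω, ω ∉ S → ω ∈ T) :
    1 - δ ≤ μ.real T := by
  have h1 : μ.real (S ∪ T) = 1 := by
    have : S ∪ T = Set.univ := Set.eq_univ_of_forall fun ω => by
      by_cases hω : ω ∈ S
      · exact Or.inl hω
      · exact Or.inr (h ω hω)
    rw [this, probReal_univ]
  linarith [measureReal_union_le (μ := μ) S T]

end gap

/-! ### The two bounds on the gap. -/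

theorem mainTheorem3 {m n K : ℕ} (hK : 0 < K)
    -- the complete problem, feasible and bounded, with full row rank and normalized costs
    (A : Matrix (Fin m) (Fin n) ℝ) (b : Fin m → ℝ) (c : Fin n → ℝ)
    (hfeas : (stdFeasible A b).Nonempty)
    (hbdd : BddBelow ((fun x => c ⬝ᵥ x) '' stdFeasible A b))
    (hrank : A.rank = m)
    (hc : l2Norm c = 1)
    -- the random indices: each has distribution `ξ`, with dependency graph `G`
    {Ω : Type*} [MeasurableSpace Ω] (μ : Measure Ω) [IsProbabilityMeasure μ]
    (J : Fin K → Ω → Fin n) (hJ : ∀ k, Measurable (J k))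
    (ξ : Fin n → ℝ) (hξ : ∀ k t, μ.real {ω | J k ω = t} = ξ t)
    (G : SimpleGraph (Fin K)) (hG : IsDependencyGraph G J μ)
    (C : ℝ) (hC : 0 ≤ C) (δ : ℝ) (hδ0 : 0 < δ) (hδ1 : δ < 1) :
    (∀ γ : ℝ, (∀ B, IsLPBasis A B → linftyNorm (dualBasicSolution A c B) ≤ γ) →
      1 - δ ≤ μ.real {ω |
        (stdFeasible (colSub A fun k => J k ω) b).Nonempty →
        (colSub A fun k => J k ω).rank = m →
        gapSampled A b c (fun k => J k ω) ≤ gapDistr A b c C ξ +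
          ((C * (1 + m * γ * maxNorm A) *
            (Real.sqrt ((K + 2 * G.edgeSet.ncard) / (K : ℝ) ^ 2) +
              Real.sqrt (2 * forestComplexity G * Real.log (2 / δ) / (K : ℝ) ^ 2)) : ℝ) :
            EReal)}) ∧
    (∀ χ : ℝ, (∀ B, IsLPBasis A B → l2Norm (reducedCost A c B) ≤ χ) →
      1 - δ ≤ μ.real {ω |
        (stdFeasible (colSub A fun k => J k ω) b).Nonempty →
        (colSub A fun k => J k ω).rank = m →
        gapSampled A b c (fun k => J k ω) ≤ gapDistr A b c C ξ +
          ((C * χ *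
            (Real.sqrt ((K + 2 * G.edgeSet.ncard) / (K : ℝ) ^ 2) +
              Real.sqrt (2 * forestComplexity G * Real.log (1 / δ) / (K : ℝ) ^ 2)) : ℝ) :
            EReal)}) := by
  by_cases hD : (distrFeasible A b C ξ).Nonempty
  swap
  · have htop : ∀ r : ℝ, gapDistr A b c C ξ + (r : EReal) = ⊤ := fun r => by
      rw [gapDistr_eq_top hfeas hD, EReal.top_add_coe]
    simp only [htop, le_top, implies_true, Set.ofPred_true, probReal_univ]
    exact ⟨fun _ _ => by linarith, fun _ _ => by linarith⟩
  obtain ⟨y, ⟨hyA, hy0, hyC⟩, hymin⟩ := exists_distr_optimal c hD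
  have hξ0 : ∀ t, 0 ≤ ξ t := fun t => hξ ⟨0, hK⟩ t ▸ measureReal_nonneg
  -- Importance weights: the induced vector `w` has mean `y`.
  set x : Ω → Fin K → ℝ := fun ω k => (K : ℝ)⁻¹ * (y (J k ω) / ξ (J k ω)) with hx
  have hx0 : ∀ ω, 0 ≤ x ω := fun ω k =>
    mul_nonneg (by positivity) (div_nonneg (hy0 _) (hξ0 _))
  set w : Ω → Fin n → ℝ := fun ω => pushSolution (fun k => J k ω) (x ω) with hw
  have hdev : ∀ ω, (K : ℝ)⁻¹ • ∑ k, weightedSingle ξ y (J k ω) - ∑ t, ξ t • weightedSingle ξ y t =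
      WithLp.toLp 2 (w ω - y) := fun ω => by
    rw [smul_sum_weightedSingle, sum_smul_weightedSingle hy0 hyC, ← WithLp.toLp_sub]
  have hdevA : ∀ ω, (K : ℝ)⁻¹ • ∑ k, Matrix.toEuclideanLin A (weightedSingle ξ y (J k ω)) -
      ∑ t, ξ t • Matrix.toEuclideanLin A (weightedSingle ξ y t) =
        WithLp.toLp 2 (A *ᵥ (w ω - y)) := fun ω => by
    simp only [← map_smul, ← map_sum, ← map_sub, hdev]
    rfl
  have hmax0 : 0 ≤ maxNorm A := Real.iSup_nonneg fun i => abs_nonneg _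
  have hnorm := norm_weightedSingle_le hC hξ0 hy0 hyC
  have hnormA := norm_toEuclideanLin_weightedSingle_le A hC hξ0 hy0 hyC
  constructor
  · intro γ hγ
    -- Two deviation events, for `w - y` and for `A (w - y)`, each get `δ / 2`, whence `log (2 /
    -- δ)`. Bound (ii) uses only the first, with the full `δ`.
    have h1 := hG.sampleMean_deviation hJ hξ hK _ hnorm hC (half_pos hδ0) (by linarith)
    have h2 := hG.sampleMean_deviation hJ hξ hK _ hnormA (by positivity) (half_pos hδ0)
      (by linarith)
    simp only [hdev, hdevA, one_div_div] at h1 h2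
    refine one_sub_le_measureReal
      ((measureReal_union_le _ _).trans ((add_le_add h1 h2).trans_eq (add_halves δ)))
      fun ω hω hne hrk => ?_
    rw [Set.mem_union, not_or, Set.mem_ofPred_eq, Set.mem_ofPred_eq, not_lt, not_lt] at hω
    obtain ⟨B, hB, hopt⟩ := exists_basis_optValue_sampled_le hbdd hne hrk
    refine gapSampled_le_gapDistr_add hymin ?_ (hopt (x ω) (hx0 ω) y hyA)
    set Q := Real.sqrt ((K + 2 * G.edgeSet.ncard) / (K : ℝ) ^ 2) +
      Real.sqrt (2 * forestComplexity G * Real.log (2 / δ) / (K : ℝ) ^ 2) with hQ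
    have hp := hγ B hB
    have hγ0 : 0 ≤ γ := le_trans (Real.iSup_nonneg fun i => abs_nonneg _) hp
    have hcost : c ⬝ᵥ (w ω - y) ≤ C * Q := by
      have := dotProduct_le_l2Norm c (w ω - y)
      rw [hc, one_mul] at this
      exact this.trans hω.1
    have hdual : (-dualBasicSolution A c B) ⬝ᵥ A *ᵥ (w ω - y) ≤ m * γ * maxNorm A * C * Q := by
      have hneg : linftyNorm (-dualBasicSolution A c B) = linftyNorm (dualBasicSolution A c B) := by
        simp [linftyNorm]
      calc _ ≤ linftyNorm (-dualBasicSolution A c B) * Real.sqrt m *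
            ‖WithLp.toLp 2 (A *ᵥ (w ω - y))‖ := dotProduct_le_linftyNorm _ _
        _ ≤ γ * Real.sqrt m * (C * (Real.sqrt m * maxNorm A) * Q) := by
            rw [hneg]
            gcongr
            exact hω.2
        _ = (Real.sqrt m * Real.sqrt m) * γ * maxNorm A * C * Q := by ring
        _ = _ := by rw [Real.mul_self_sqrt (Nat.cast_nonneg m)]
    -- Splitting `c̄ᵀ(w - y) = cᵀ(w - y) - pᵀA(w - y)` produces the two summands of `1 + m γ
    -- ‖A‖_max`.
    rw [reducedCost, sub_dotProduct, ← dotProduct_mulVec]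
    rw [neg_dotProduct] at hdual
    calc _ ≤ C * Q + m * γ * maxNorm A * C * Q := by linarith
      _ = _ := by ring
  · intro χ hχ
    have h1 := hG.sampleMean_deviation hJ hξ hK _ hnorm hC hδ0 hδ1.le
    simp only [hdev] at h1
    refine one_sub_le_measureReal h1 fun ω hω hne hrk => ?_
    rw [Set.mem_ofPred_eq, not_lt] at hω
    obtain ⟨B, hB, hopt⟩ := exists_basis_optValue_sampled_le hbdd hne hrk
    refine gapSampled_le_gapDistr_add hymin ?_ (hopt (x ω) (hx0 ω) y hyA)
    have hχ0 : 0 ≤ χ := le_trans (Real.sqrt_nonneg _) (hχ B hB)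
    calc _ ≤ l2Norm (reducedCost A c B) * ‖WithLp.toLp 2 (w ω - y)‖ := dotProduct_le_l2Norm _ _
      _ ≤ χ * _ := mul_le_mul (hχ B hB) hω (norm_nonneg _) hχ0
      _ = _ := by ring
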